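/- **Terms.** First-order terms are built from countably many variables and, for each arity $k$, countably many function symbols of arity $k$ (numbered by $\mathbb N$; constants have arity $0$). Among them are a distinguished binary symbol $\bullet$ (infix, associating to the right), a unary symbol $\mathtt{head}$ and three distinct constants $\star,\mathtt l,\mathtt r$. The height of a term is the maximal distance from its root to a leaf; the height of an occurrence of a variable is its distance to the root. **Flows and wirings.** A *flow* $t\leftharpoonup u$ is a pair of terms with $\mathrm{Var}(t)\subseteq\mathrm{Var}(u)$, up to renaming of variables by a permutation. Choosing representatives with disjoint sets of variables, the product $(t\leftharpoonup u)(v\leftharpoonup w)$ is defined if $u,v$ are unifiable, and is then $\theta t\leftharpoonup\theta w$ with $\theta$ a most general unifier of $u,v$; moreover $(t\leftharpoonup u)\bullet(v\leftharpoonup w):=t\bullet v\leftharpoonup u\bullet w$. A *wiring* is a finite set of flows; sums are unions, $0=\varnothing$, $FG=\{fg: f\in F, g\in G, fg\text{ defined}\}$, $F\bullet G=\{f\bullet g: f\in F,g\in G\}$, the unit is $x\leftharpoonup x$. $F$ is *nilpotent* if $F^n=0$ for some $n$. The height is $h(t\leftharpoonup u)=\max(h(t),h(u))$, $h(F)=\max_{f\in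 F}h(f)$, $h(0)=0$. For sets $A,B$ of wirings closed under sums and products, $A\bullet B$ is the set of all finite sums $\sum_i F_i\bullet G_i$ with $F_i\in A$, $G_i\in B$. **Stack.** $\mathit{Stack}$ is the set of wirings all of whose flows are of the form $\tau(x)\leftharpoonup\sigma(x)$ with $\tau,\sigma$ finite sequences of unary function symbols and $x$ a variable. A flow $t\leftharpoonup u$ is *balanced* if for each variable all its occurrences in $t$ and $u$ have the same height; $\mathcal B$ is the set of wirings all of whose flows are balanced. **Words and observations.** Let $P$ be an infinite set of constants (position constants) and $\Sigma$ a finite set of constants, with $\Sigma\cap P=\varnothing$, $\star\notin\Sigma$ and $\star,\mathtt l,\mathtt r\notin P$. Let $m\ge 0$. For a word $W=c_1\cdots c_n\in\Sigma^*$ and pairwise distinct $p=(p_0,\dots,p_n)$ in $P$, put $c_0=c_{n+1}=\star$, $p_{n+1}=p_0$ and $$\overline W_p=\sum_{i=0}^{n}\bigl(a_i\leftharpoonup b_{i+1}\bigr)+\bigl(b_{i+1}\leftharpoonup a_i\bigr),\qquad a_i=c_i\bullet\mathtt r\bullet x_1\bullet\cdots\bullet x_m\bullet\mathtt{head}(p_i),\quad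 b_i=c_i\bullet\mathtt l\bullet x_1\bullet\cdots\bullet x_m\bullet\mathtt{head}(p_i),$$ with $x_1,\dots,x_m$ distinct variables. An *observation with stack* is a wiring that uses no constant of $P$ and is a finite sum of flows $c\bullet d\bullet t\leftharpoonup c'\bullet d'\bullet u$ with $c,c'\in\Sigma\cup\{\star\}$, $d,d'\in\{\mathtt l,\mathtt r\}$ and $t\leftharpoonup u$ a flow of a wiring in $\mathit{Stack}\bullet\mathcal B$. **Proposition.** Let $O$ be an observation with stack. There is a procedure $\mathrm{Red}_O$, computable by a Turing machine in time polynomial in the length of its input, which, given a word $W\in\Sigma^*$, outputs a wiring $F$ (written as the list of its flows, terms being in prefix notation and the numbers of symbols and variables in binary) such that $F\in\mathit{Stack}$, $h(F)\le h(O)$, and, for every choice of pairwise distinct position constants $p=(p_0,\dots,p_n)$ in $P$, where $n$ is the length of $W$: $F$ is nilpotent if and only if $O\,\overline W_p$ is nilpotent. -/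

import Mathlib

namespace UnaryResolution

/-! ### First-order terms -/

/-- The signature: for every arity `k`, the function symbols of arity `k` are indexed by `ℕ`. -/
abbrev sig : FirstOrder.Language.{0, 0} := ⟨fun _ => ℕ, fun _ => Empty⟩

/-- First-order terms over the signature; the variables are indexed by `ℕ`. -/
abbrev Tm : Type := sig.Term ℕ

/-- The variable number `x`. -/
def tvar (x : ℕ) : Tm := FirstOrder.Language.Term.var x

/-- The term made of the constant symbol number `c`. -/
def const (c : ℕ) : Tm := FirstOrder.Language.Term.func (L := sig) (l := 0) c Fin.elim0

/-- The term `g(t)`, where `g` is the unary function symbol number `g`. -/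
def app (g : ℕ) (t : Tm) : Tm := FirstOrder.Language.Term.func (L := sig) (l := 1) g ![t]

/-- The term `t • u`, where `•` is a distinguished binary function symbol. -/
def dot (t u : Tm) : Tm := FirstOrder.Language.Term.func (L := sig) (l := 2) (0 : ℕ) ![t, u]

/-- The distinguished constant symbol `⋆`. -/
def star : ℕ := 0

/-- The constant symbol `l`. -/
def lft : ℕ := 1

/-- The constant symbol `r`. -/
def rgt : ℕ := 2

/-- The unary function symbol `head`. -/
def hd : ℕ := 0

/-- The height of a term: the maximal distance between its root and its leaves. -/
def height : Tm → ℕ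
  | .var _ => 0
  | .func _ ts => Finset.univ.sup fun i => height (ts i) + 1

/-- The set of the heights (distances to the root) of the occurrences of the variable `x`. -/
def occHeights (x : ℕ) : Tm → Set ℕ
  | .var y => {n | y = x ∧ n = 0}
  | .func _ ts => {n | ∃ i, ∃ m ∈ occHeights x (ts i), n = m + 1}

/-- The set of the constant symbols that occur in a term. -/
def consts : Tm → Set ℕ
  | .var _ => ∅
  | .func (l := k) f ts => {c | (k = 0 ∧ f = c) ∨ ∃ i, c ∈ consts (ts i)}

/-- `θ` is a most general unifier of `t` and `u`. -/
def IsMGU (θ : ℕ → Tm) (t u : Tm) : Prop :=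
  t.subst θ = u.subst θ ∧
    ∀ η : ℕ → Tm, t.subst η = u.subst η → ∃ ρ : ℕ → Tm, ∀ x, η x = (θ x).subst ρ

theorem varFinset_subst (t : Tm) (θ : ℕ → Tm) :
    (t.subst θ).varFinset = t.varFinset.biUnion fun x => (θ x).varFinset := by
  induction t with
  | var x => simp [FirstOrder.Language.Term.subst, FirstOrder.Language.Term.varFinset]
  | func f ts ih =>
    ext y
    simp only [FirstOrder.Language.Term.subst, FirstOrder.Language.Term.varFinset, ih, Finset.mem_biUnion,
      Finset.mem_univ, true_and]
    constructor
    · rintro ⟨i, x, hx, hy⟩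
      exact ⟨x, ⟨i, hx⟩, hy⟩
    · rintro ⟨x, ⟨i, hx⟩, hy⟩
      exact ⟨i, x, hx, hy⟩

theorem height_relabel (α : ℕ → ℕ) (t : Tm) : height (t.relabel α) = height t := by
  induction t with
  | var x => rfl
  | func f ts ih =>
    simp only [FirstOrder.Language.Term.relabel, height]
    exact congrArg _ (funext fun i => by rw [ih i])

/-! ### Flows -/

/-- A representative `head ↼ body` of a flow. -/
structure RawFlow where
  head : Tm
  body : Tm
  vars_subset : head.varFinset ⊆ body.varFinset

/-- The variables of a representative. -/
def RawFlow.vars (a : RawFlow) : Finset ℕ := a.body.varFinset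

/-- Two representatives denote the same flow when they differ by a renaming. -/
def RawFlow.Renamed (a b : RawFlow) : Prop :=
  ∃ α : Equiv.Perm ℕ, b.head = a.head.relabel α ∧ b.body = a.body.relabel α

theorem RawFlow.renamed_equivalence : Equivalence RawFlow.Renamed where
  refl a := ⟨Equiv.refl ℕ, by simp, by simp⟩
  symm := by
    rintro a b ⟨α, h1, h2⟩
    exact ⟨α.symm, by simp [h1], by simp [h2]⟩
  trans := by
    rintro a b c ⟨α, h1, h2⟩ ⟨β, h3, h4⟩
    exact ⟨α.trans β, by simp [h3, h1], by simp [h4, h2]⟩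

instance flowSetoid : Setoid RawFlow := ⟨RawFlow.Renamed, RawFlow.renamed_equivalence⟩

/-- A flow: a pair `t ↼ u` of terms with `Var t ⊆ Var u`, up to renaming. -/
def Flow : Type := Quotient flowSetoid

/-- The flow denoted by a representative. -/
def RawFlow.toFlow (a : RawFlow) : Flow := Quotient.mk flowSetoid a

/-- The height of a flow. -/
def Flow.height : Flow → ℕ :=
  Quotient.lift (fun a => max (UnaryResolution.height a.head) (UnaryResolution.height a.body)) (by
    rintro a b ⟨α, h1, h2⟩
    simp only [h1, h2, height_relabel])

/-- The representative `θ t ↼ θ w` obtained from `t ↼ u` and `v ↼ w` when `θ u = θ v`. -/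
def RawFlow.resolvent (a b : RawFlow) (θ : ℕ → Tm) (h : a.body.subst θ = b.head.subst θ) :
    RawFlow where
  head := a.head.subst θ
  body := b.body.subst θ
  vars_subset := by
    have h1 : (a.head.subst θ).varFinset ⊆ (a.body.subst θ).varFinset := by
      rw [varFinset_subst, varFinset_subst]
      exact Finset.biUnion_subset_biUnion_of_subset_left _ a.vars_subset
    have h2 : (b.head.subst θ).varFinset ⊆ (b.body.subst θ).varFinset := by
      rw [varFinset_subst, varFinset_subst]
      exact Finset.biUnion_subset_biUnion_of_subset_left _ b.vars_subset
    rw [h] at h1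
    exact h1.trans h2

/-- `fg` is defined and equal to `h`. -/
def IsProduct (f g h : Flow) : Prop :=
  ∃ a b : RawFlow, a.toFlow = f ∧ b.toFlow = g ∧ Disjoint a.vars b.vars ∧
    ∃ (θ : ℕ → Tm) (hθ : IsMGU θ a.body b.head), h = (a.resolvent b θ hθ.1).toFlow

/-- The representative `u • t ↼ v • w` obtained from `u ↼ v` and `t ↼ w`. -/
def RawFlow.dot (a b : RawFlow) : RawFlow where
  head := UnaryResolution.dot a.head b.head
  body := UnaryResolution.dot a.body b.body
  vars_subset := by
    intro x
    simp only [UnaryResolution.dot, FirstOrder.Language.Term.varFinset, Finset.mem_biUnion,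
      Finset.mem_univ, true_and, Fin.exists_fin_two, Matrix.cons_val_zero, Matrix.cons_val_one]
    exact Or.imp (fun h => a.vars_subset h) (fun h => b.vars_subset h)

/-- `f • g = h`. -/
def IsDot (f g h : Flow) : Prop :=
  ∃ a b : RawFlow, a.toFlow = f ∧ b.toFlow = g ∧ Disjoint a.vars b.vars ∧ h = (a.dot b).toFlow

/-! ### Wirings

Wirings are the finite sets of flows; `+` is `∪` and `0` is `∅`. The operations below are written
for arbitrary sets of flows and preserve finiteness. -/

/-- The product of two wirings. -/
def wmul (F G : Set Flow) : Set Flow := {h | ∃ f ∈ F, ∃ g ∈ G, IsProduct f g h}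

/-- The wiring `F • G`. -/
def wdot (F G : Set Flow) : Set Flow := {h | ∃ f ∈ F, ∃ g ∈ G, IsDot f g h}

/-- The unit `x ↼ x` of the product. -/
def wone : Set Flow := {(⟨tvar 0, tvar 0, subset_rfl⟩ : RawFlow).toFlow}

/-- The powers of a wiring. -/
def wpow (F : Set Flow) : ℕ → Set Flow
  | 0 => wone
  | n + 1 => wmul (wpow F n) F

/-- `F ^ n = 0` for some `n`. -/
def Nilpotent (F : Set Flow) : Prop := ∃ n, wpow F n = ∅

/-- The height of a wiring: the maximum of the heights of its flows, `0` for the empty wiring. -/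
noncomputable def wheight (F : Set Flow) : ℕ := sSup (Flow.height '' F)

/-! ### Semirings of wirings -/

/-- The semiring generated by a set of flows. -/
inductive Generated (S : Set Flow) : Set Flow → Prop
  | single (f : Flow) (hf : f ∈ S) : Generated S {f}
  | zero : Generated S ∅
  | add (F G : Set Flow) : Generated S F → Generated S G → Generated S (F ∪ G)
  | mul (F G : Set Flow) : Generated S F → Generated S G → Generated S (wmul F G)

/-- The semiring `A • B` of all the finite sums `∑ Fᵢ • Gᵢ` with `Fᵢ ∈ A` and `Gᵢ ∈ B`. -/
def semiringDot (A B : Set (Set Flow)) : Set (Set Flow) :=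
  {H | ∃ L : List (Set Flow × Set Flow), (∀ q ∈ L, q.1 ∈ A ∧ q.2 ∈ B) ∧
    H = {h | ∃ q ∈ L, h ∈ wdot q.1 q.2}}

/-- The term `τ(t)` for a sequence `τ` of unary function symbols. -/
def seqApp (τ : List ℕ) (t : Tm) : Tm := τ.foldr app t

/-- A unary flow is built from unary function symbols and one variable only. -/
def IsUnary (f : Flow) : Prop :=
  ∃ (a : RawFlow) (τ σ : List ℕ) (x : ℕ), a.toFlow = f ∧
    a.head = seqApp τ (tvar x) ∧ a.body = seqApp σ (tvar x)

/-- The semiring `Stack`. -/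
def stack : Set (Set Flow) := {F | F.Finite ∧ ∀ f ∈ F, IsUnary f}

/-- A flow `t ↼ u` is balanced if, for every variable `x`, all the occurrences of `x` in `t` and
in `u` have the same height. -/
def IsBalanced (f : Flow) : Prop :=
  ∃ a : RawFlow, a.toFlow = f ∧
    ∀ x, ∀ m ∈ occHeights x a.head ∪ occHeights x a.body,
      ∀ n ∈ occHeights x a.head ∪ occHeights x a.body, m = n

/-- The semiring of balanced wirings. -/
def balanced : Set (Set Flow) := {F | F.Finite ∧ ∀ f ∈ F, IsBalanced f}

/-- The wirings that do not use the constant symbols in `P`. -/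
def unused (P : Set ℕ) : Set (Set Flow) :=
  {F | F.Finite ∧ ∀ f ∈ F, ∃ a : RawFlow, a.toFlow = f ∧
    Disjoint (consts a.head ∪ consts a.body) P}

/-- The flow `c ↼ c'` between constants. -/
def constFlow (c c' : ℕ) : Flow :=
  (⟨const c, const c', by simp [const, FirstOrder.Language.Term.varFinset]⟩ : RawFlow).toFlow

/-- The semiring generated by the flows `c ↼ c'` with `c, c' ∈ C`. -/
def constSemiring (C : Set ℕ) : Set (Set Flow) :=
  {F | Generated {f | ∃ c ∈ C, ∃ c' ∈ C, f = constFlow c c'} F}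

/-- The observations over the semiring `A`, for the alphabet `Sig` and the position constants `P`:
sums of flows `c • d • t ↼ c' • d' • u` with `c, c' ∈ Sig ∪ {⋆}`, `d, d' ∈ {l, r}` and `t ↼ u` taken
from `A`, that do not use `P`. As everywhere, `•` associates to the right: the semiring generated
by the flows `c • d ↼ c' • d'` is the product of the two semirings of constants used here. -/
def observations (Sig : Finset ℕ) (P : Set ℕ) (A : Set (Set Flow)) : Set (Set Flow) :=
  semiringDot (constSemiring (insert star (Sig : Set ℕ)))
    (semiringDot (constSemiring {lft, rgt}) A) ∩ unused P

/-- The observations with stack. -/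
def stackObservations (Sig : Finset ℕ) (P : Set ℕ) : Set (Set Flow) :=
  observations Sig P (semiringDot stack balanced)

/-! ### Representation of words -/

/-- The term `x₀ • x₁ • ⋯ • xₘ₋₁ • t`. -/
def slots (m : ℕ) (t : Tm) : Tm := (List.range m).foldr (fun x u => dot (tvar x) u) t

/-- The term `c • d • x₀ • ⋯ • xₘ₋₁ • head(p)`. -/
def wordTerm (m c d p : ℕ) : Tm := dot (const c) (dot (const d) (slots m (app hd (const p))))

/-- The letters `c₀, …, cₙ` attached to the positions of the word `c₁⋯cₙ`, with `c₀ = ⋆`. -/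
def letter {Sig : Finset ℕ} (W : List Sig) : Fin (W.length + 1) → ℕ :=
  Fin.cons star fun i => (W.get i : ℕ)

/-- The representation of the word `W` associated with `p₀, …, pₙ`: the sum over `i = 0, …, n` of
`cᵢ • r • x₀ • ⋯ • xₘ₋₁ • head(pᵢ) ⇌ cᵢ₊₁ • l • x₀ • ⋯ • xₘ₋₁ • head(pᵢ₊₁)`, where the index `i + 1`
is taken modulo `n + 1` (this is addition in `Fin (n + 1)`). -/
def wordRep (m : ℕ) {Sig : Finset ℕ} (W : List Sig) (p : Fin (W.length + 1) → ℕ) : Set Flow :=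
  {f | ∃ (i : Fin (W.length + 1)) (a : RawFlow), a.toFlow = f ∧
    ((a.head = wordTerm m (letter W i) rgt (p i) ∧
        a.body = wordTerm m (letter W (i + 1)) lft (p (i + 1))) ∨
      (a.head = wordTerm m (letter W (i + 1)) lft (p (i + 1)) ∧
        a.body = wordTerm m (letter W i) rgt (p i)))}

/-! ### Wirings as strings -/

/-- A number in binary, followed by a comma. -/
def encodeNum (n : ℕ) : List Computability.Γ' :=
  (Computability.encodeNat n).map Computability.Γ'.bit ++ [Computability.Γ'.comma]

/-- The string for a variable or for a function symbol (its arity, then its number). -/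
def encodeSymbol : ℕ ⊕ (Σ k, sig.Functions k) → List Computability.Γ'
  | .inl x => Computability.Γ'.bra :: encodeNum x
  | .inr s => Computability.Γ'.ket :: (encodeNum s.1 ++ encodeNum s.2)

/-- The string for a list of flows: the terms `head, body, head, body, …`, in prefix notation. -/
def encodeFlows (L : List RawFlow) : List Computability.Γ' :=
  ((L.flatMap fun a => [a.head, a.body]).flatMap FirstOrder.Language.Term.listEncode).flatMap encodeSymbol

/-- The wiring denoted by a list of flows. -/
def wiringOf (L : List RawFlow) : Set Flow := {f | ∃ a ∈ L, a.toFlow = f}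

theorem encodeNum_append_inj {m n : ℕ} {r s : List Computability.Γ'}
    (h : encodeNum m ++ r = encodeNum n ++ s) : m = n ∧ r = s := by
  have key : ∀ (u v : List Bool), u.map Computability.Γ'.bit ++ Computability.Γ'.comma :: r =
      v.map Computability.Γ'.bit ++ Computability.Γ'.comma :: s → u = v ∧ r = s := by
    intro u
    induction u with
    | nil => intro v hv; cases v <;> simp_all
    | cons b u ih =>
      intro v hv
      cases v with
      | nil => simp at hv
      | cons c v =>
        simp only [List.map_cons, List.cons_append, List.cons.injEq,
          Computability.Γ'.bit.injEq] at hv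
        obtain ⟨h1, h2⟩ := ih v hv.2
        exact ⟨by rw [hv.1, h1], h2⟩
  obtain ⟨h1, h2⟩ := key _ _ (by simpa [encodeNum] using h)
  exact ⟨Computability.encodingNatBool.encode_injective h1, h2⟩

theorem encodeSymbols_injective :
    Function.Injective fun l : List (ℕ ⊕ (Σ k, sig.Functions k)) => l.flatMap encodeSymbol := by
  intro l
  induction l with
  | nil =>
    intro l' h
    rcases l' with _ | ⟨x | x, l'⟩ <;> simp_all [encodeSymbol]
  | cons x l ih =>
    intro l' h
    rcases l' with _ | ⟨y, l'⟩
    · rcases x with x | x <;> simp [encodeSymbol] at h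
    · simp only [List.flatMap_cons] at h
      rcases x with x | ⟨k, x⟩ <;> rcases y with y | ⟨k', y⟩ <;>
        simp only [encodeSymbol, List.cons_append, List.cons.injEq, true_and, reduceCtorEq,
          false_and, List.append_assoc] at h
      · obtain ⟨rfl, h2⟩ := encodeNum_append_inj h
        rw [ih h2]
      · obtain ⟨rfl, h2⟩ := encodeNum_append_inj h
        obtain ⟨h3, h4⟩ := encodeNum_append_inj h2
        rw [ih h4]
        exact congrArg (fun z => Sum.inr ⟨k, z⟩ :: l') h3

/-- The string determines the list of flows. -/
theorem encodeFlows_injective : Function.Injective encodeFlows := by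
  intro L L' h
  have h1 := encodeSymbols_injective h
  have h2 : (L.flatMap fun a => [a.head, a.body]) = L'.flatMap fun a => [a.head, a.body] := by
    rw [← FirstOrder.Language.Term.listDecode_encode_list (L.flatMap fun a => [a.head, a.body]), h1,
      FirstOrder.Language.Term.listDecode_encode_list]
  clear h h1
  induction L generalizing L' with
  | nil => cases L' <;> simp_all
  | cons a L ih =>
    cases L' with
    | nil => simp at h2
    | cons b L' =>
      obtain ⟨h3, h4, h5⟩ : a.head = b.head ∧ a.body = b.body ∧ _ := by simpa using h2
      rw [ih h5]
      cases a; cases b; simp_all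

/-- The class FPtime, for procedures that take words and output wirings: `R` is computed by a
Turing machine in a time bounded by a polynomial in the length of the word. -/
def FPtime {Sig : Finset ℕ} (R : List Sig → List RawFlow) : Prop :=
  Nonempty (Turing.TM2ComputableInPolyTime (fun W : List Sig => W) encodeFlows R)

end UnaryResolution

open UnaryResolution

namespace UnaryResolution
open FirstOrder.Language

/-! ### Substitutions -/

/-! For nilpotency, a flow may be replaced by the relation formed by its instances. Unifiable terms
have most general unifiers, so products of wirings become compositions of relations
(`wiringRel_wmul`), and a wiring is empty exactly when its relation is. Nilpotency therefore means
that the lengths of paths are bounded (`nilpotent_iff`).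

The paths of the observation times the word alternate between a step of each, on nodes `(s, c, d,
y)`: here `s` is the stack, which the word leaves alone, and `y` is the balanced part, which also
carries the position (`longPaths_wmul`). Balance makes `y` effectively finite. All occurrences of a
variable in a rule lie at one height, so cutting `y` at a fixed depth commutes with instantiation
(`trunc_subst`). The position constants, absent from the rules, are replaced by variables that
number the positions, and a substitution restores them. Hence only terms of bounded height over a
finite set of symbols matter, and the choice of the constants disappears (`longPaths_truncate`).

The data `c`, `d`, `y` and a phase bit then form a finite state, coded by one unary symbol on top of
the stack. This yields a wiring in `stack`; the phase bit enforces the alternation, so that rules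
and moves of the word stay separate flows (`longPaths_reduction`). In the observation the stack
words lie below three `•`, so the extra symbol does not exceed the allowed height.

For the complexity, bounded terms have at most `K` variables, with `K` independent of the word. All
flows come from finitely many templates, selected by two adjacent letters, renamed along the tuples
of `K + 1` positions (`RuleInstance.exists_template`, `MoveInstance.exists_template`). A machine
that keeps one zipper on the word for each component enumerates these tuples. The symbols are
numbered so that their binary digits contain the positions in unary, which the machine prints by
copying (`Printer.computable`, `fptime_reduction`). -/

theorem subst_subst (t : Tm) (θ ρ : ℕ → Tm) :
    (t.subst θ).subst ρ = t.subst fun x => (θ x).subst ρ := by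
  induction t with
  | var x => rfl
  | func f ts ih => simp [ih]

theorem subst_tvar (t : Tm) : t.subst tvar = t := by
  induction t with
  | var x => rfl
  | func f ts ih => simp [ih]

theorem subst_congr {t : Tm} {θ ρ : ℕ → Tm} (h : ∀ x ∈ t.varFinset, θ x = ρ x) :
    t.subst θ = t.subst ρ := by
  induction t with
  | var x => exact h x (by simp)
  | func f ts ih =>
    simp only [Term.subst, Term.func.injEq, heq_eq_eq, true_and]
    funext i
    exact ih i fun x hx => h x (by simp only [Term.varFinset, Finset.mem_biUnion]; exact ⟨i, by simp, hx⟩)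

theorem relabel_eq_subst (t : Tm) (α : ℕ → ℕ) : t.relabel α = t.subst fun x => tvar (α x) := by
  induction t with
  | var x => rfl
  | func f ts ih => simp [ih]

theorem subst_relabel (t : Tm) (α : ℕ → ℕ) (θ : ℕ → Tm) :
    (t.relabel α).subst θ = t.subst fun x => θ (α x) := by
  rw [relabel_eq_subst, subst_subst]; rfl

theorem relabel_subst (t : Tm) (α : ℕ → ℕ) (θ : ℕ → Tm) :
    (t.subst θ).relabel α = t.subst fun x => (θ x).relabel α := by
  simp only [relabel_eq_subst, subst_subst]

theorem relabel_congr {t : Tm} {α β : ℕ → ℕ} (h : ∀ x ∈ t.varFinset, α x = β x) :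
    t.relabel α = t.relabel β := by
  rw [relabel_eq_subst, relabel_eq_subst]
  exact subst_congr fun x hx => by rw [h x hx]

theorem varFinset_relabel (t : Tm) (α : ℕ → ℕ) : (t.relabel α).varFinset = t.varFinset.image α := by
  rw [relabel_eq_subst, varFinset_subst]
  ext x
  simp [tvar, eq_comm]

/-! ### Existence of most general unifiers -/

/-- The number of symbols of a term. -/
def tsize : Tm → ℕ
  | .var _ => 1
  | .func _ ts => (∑ i, tsize (ts i)) + 1

theorem one_le_tsize (t : Tm) : 1 ≤ tsize t := by
  cases t <;> simp [tsize]

theorem tsize_le_tsize_subst {t : Tm} {x : ℕ} (hx : x ∈ t.varFinset) (η : ℕ → Tm) :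
    tsize (η x) ≤ tsize (t.subst η) := by
  induction t with
  | var y => simp only [Term.varFinset, Finset.mem_singleton] at hx; subst hx; rfl
  | func f ts ih =>
    simp only [Term.varFinset, Finset.mem_biUnion] at hx
    obtain ⟨i, -, hi⟩ := hx
    have h1 := Finset.single_le_sum (f := fun i => tsize ((ts i).subst η)) (fun _ _ => Nat.zero_le _)
      (Finset.mem_univ i)
    have h2 := ih i hi
    simp only [Term.subst, tsize]
    omega

/-- The occurs check: if `x` lay strictly inside `t`, then `t.subst η` would have more symbols than
`η x`. -/
theorem var_eq_of_subst_eq {t : Tm} {x : ℕ} (hx : x ∈ t.varFinset) {η : ℕ → Tm}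
    (h : η x = t.subst η) : t = tvar x := by
  cases t with
  | var y => simp only [Term.varFinset, Finset.mem_singleton] at hx; subst hx; rfl
  | func f ts =>
    simp only [Term.varFinset, Finset.mem_biUnion] at hx
    obtain ⟨i, -, hi⟩ := hx
    have h1 := Finset.single_le_sum (f := fun i => tsize ((ts i).subst η)) (fun _ _ => Nat.zero_le _)
      (Finset.mem_univ i)
    have h2 := tsize_le_tsize_subst hi η
    have h3 := congrArg tsize h
    simp only [Term.subst, tsize] at h3
    omega

/-- `θ` unifies all the equations of the list `E`. -/
def Unifies (θ : ℕ → Tm) (E : List (Tm × Tm)) : Prop := ∀ e ∈ E, e.1.subst θ = e.2.subst θ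

/-- The variables of a list of equations. -/
def eqVars : List (Tm × Tm) → Finset ℕ
  | [] => ∅
  | e :: E => e.1.varFinset ∪ e.2.varFinset ∪ eqVars E

/-- The number of symbols of a list of equations. -/
def eqSize (E : List (Tm × Tm)) : ℕ := (E.map fun e => tsize e.1 + tsize e.2).sum

theorem mem_eqVars {E : List (Tm × Tm)} {x : ℕ} :
    x ∈ eqVars E ↔ ∃ e ∈ E, x ∈ e.1.varFinset ∨ x ∈ e.2.varFinset := by
  induction E with
  | nil => simp [eqVars]
  | cons e E ih => simp [eqVars, ih, or_assoc]

/-- The substitution of `t` for the variable `x`. -/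
def single (x : ℕ) (t : Tm) : ℕ → Tm := Function.update tvar x t

/-- A solution of the equation `x = t` absorbs the substitution of `t` for `x`, so eliminating `x`
from other equations keeps the same common solutions. -/
theorem subst_single_of_eq {x : ℕ} {t : Tm} {η : ℕ → Tm} (h : η x = t.subst η) (s : Tm) :
    (s.subst (single x t)).subst η = s.subst η := by
  rw [subst_subst]
  congr 1
  funext y
  rcases eq_or_ne y x with rfl | hy
  · simp [single, h]
  · simp [single, hy, tvar]

theorem varFinset_subst_single {x : ℕ} {t : Tm} (hx : x ∉ t.varFinset) (s : Tm) :
    (s.subst (single x t)).varFinset ⊆ (s.varFinset ∪ t.varFinset).erase x := by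
  intro y hy
  rw [varFinset_subst, Finset.mem_biUnion] at hy
  obtain ⟨z, hz, hy⟩ := hy
  rcases eq_or_ne z x with rfl | hzx
  · simp only [single, Function.update_self] at hy
    have : y ≠ z := by rintro rfl; exact hx hy
    simp [this, hy]
  · simp only [single, Function.update_of_ne hzx, tvar, Term.varFinset, Finset.mem_singleton] at hy
    subst hy
    simp [hzx, hz]

/-- The elimination step of unification. After the substitution the variable `x` is gone, so `ih`
applies; its unifier preceded by `single x t` solves the original system. -/
theorem exists_mgu_eliminate {x : ℕ} {t : Tm} {E : List (Tm × Tm)} (hx : x ∉ t.varFinset)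
    {η₀ : ℕ → Tm} (h0 : η₀ x = t.subst η₀) (hE : Unifies η₀ E)
    (ih : ∀ E' : List (Tm × Tm), (eqVars E').card < (insert x (t.varFinset ∪ eqVars E)).card →
      Unifies η₀ E' → ∃ θ, Unifies θ E' ∧ ∀ η, Unifies η E' → ∃ ρ, ∀ y, η y = (θ y).subst ρ) :
    ∃ θ, (θ x = t.subst θ ∧ Unifies θ E) ∧
      ∀ η, η x = t.subst η → Unifies η E → ∃ ρ, ∀ y, η y = (θ y).subst ρ := by
  let E' := E.map fun e => (e.1.subst (single x t), e.2.subst (single x t))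
  have key : ∀ η, η x = t.subst η → (Unifies η E' ↔ Unifies η E) := by
    intro η hη
    simp only [Unifies, E', List.mem_map, forall_exists_index, and_imp,
      forall_apply_eq_imp_iff₂, subst_single_of_eq hη]
  have hcard : (eqVars E').card < (insert x (t.varFinset ∪ eqVars E)).card := by
    apply Finset.card_lt_card
    rw [Finset.ssubset_iff_of_subset]
    · refine ⟨x, by simp, fun h => ?_⟩
      obtain ⟨e, he, h⟩ := mem_eqVars.1 h
      obtain ⟨e', -, rfl⟩ := List.mem_map.1 he
      rcases h with h | h <;> simpa using varFinset_subst_single hx _ h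
    · intro y h
      obtain ⟨e, he, h⟩ := mem_eqVars.1 h
      obtain ⟨e', he', rfl⟩ := List.mem_map.1 he
      have : y ∈ e'.1.varFinset ∪ e'.2.varFinset ∪ t.varFinset := by
        rcases h with h | h
        · have := Finset.mem_of_mem_erase (varFinset_subst_single hx _ h)
          simp only [Finset.mem_union] at this ⊢; tauto
        · have := Finset.mem_of_mem_erase (varFinset_subst_single hx _ h)
          simp only [Finset.mem_union] at this ⊢; tauto
      simp only [Finset.mem_insert, Finset.mem_union] at this ⊢
      rcases this with (h | h) | h
      · exact Or.inr (Or.inr (mem_eqVars.2 ⟨e', he', Or.inl h⟩))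
      · exact Or.inr (Or.inr (mem_eqVars.2 ⟨e', he', Or.inr h⟩))
      · exact Or.inr (Or.inl h)
  obtain ⟨θ, hθ, hmg⟩ := ih E' hcard ((key η₀ h0).2 hE)
  have hself : t.subst (single x t) = t := by
    conv_rhs => rw [← subst_tvar t]
    refine subst_congr fun y hy => ?_
    have : y ≠ x := by rintro rfl; exact hx hy
    simp [single, this]
  have hθx : (fun y => (single x t y).subst θ) x = t.subst fun y => (single x t y).subst θ := by
    simp only [← subst_subst, hself]
    simp [single]
  refine ⟨fun y => (single x t y).subst θ, ⟨hθx, ?_⟩, ?_⟩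
  · intro e he
    rw [← subst_subst, ← subst_subst]
    exact hθ _ (List.mem_map.2 ⟨e, he, rfl⟩)
  · intro η h1 h2
    obtain ⟨ρ, hρ⟩ := hmg η ((key η h1).2 h2)
    refine ⟨ρ, fun y => ?_⟩
    have : (single x t y).subst η = η y := by
      have := subst_single_of_eq h1 (tvar y)
      simpa [tvar] using this
    rw [← this, subst_subst]
    congr 1
    funext z
    exact hρ z

theorem eqSize_cons (e : Tm × Tm) (E : List (Tm × Tm)) :
    eqSize (e :: E) = tsize e.1 + tsize e.2 + eqSize E := by simp [eqSize]

/-- A unifiable list of equations has a most general unifier. -/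
theorem exists_mgu_list (E : List (Tm × Tm)) (η₀ : ℕ → Tm) (hE : Unifies η₀ E) :
    ∃ θ, Unifies θ E ∧ ∀ η, Unifies η E → ∃ ρ, ∀ y, η y = (θ y).subst ρ := by
  -- Lexicographic induction on the number of variables, then of symbols. Elimination lowers the
  -- first; decomposing or dropping an equation lowers the second and adds no variable.
  obtain ⟨N, hN⟩ : ∃ N, N = (eqVars E).card := ⟨_, rfl⟩
  induction N using Nat.strong_induction_on generalizing E with
  | _ N ihN =>
  obtain ⟨M, hM⟩ : ∃ M, M = eqSize E := ⟨_, rfl⟩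
  induction M using Nat.strong_induction_on generalizing E N with
  | _ M ihM =>
  have ih1 : ∀ E' : List (Tm × Tm), (eqVars E').card < (eqVars E).card →
      Unifies η₀ E' → ∃ θ, Unifies θ E' ∧ ∀ η, Unifies η E' → ∃ ρ, ∀ y, η y = (θ y).subst ρ :=
    fun E' h1 h2 => ihN _ (hN ▸ h1) E' h2 rfl
  have ih2 : ∀ E' : List (Tm × Tm), eqVars E' ⊆ eqVars E → eqSize E' < eqSize E →
      Unifies η₀ E' → ∃ θ, Unifies θ E' ∧ ∀ η, Unifies η E' → ∃ ρ, ∀ y, η y = (θ y).subst ρ :=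
    fun E' h1 h2 h3 => ihM _ (hM ▸ h2) _
      (fun N' hN' E'' => ihN N' (hN ▸ hN'.trans_le (Finset.card_le_card h1)) E'') E' h3 rfl rfl
  clear ihM ihN hN hM
  have elim : ∀ (x : ℕ) (t : Tm) (E' : List (Tm × Tm)), eqVars E = insert x (t.varFinset ∪ eqVars E') →
      eqVars E' ⊆ eqVars E → eqSize E' < eqSize E →
      (∀ η, Unifies η E ↔ η x = t.subst η ∧ Unifies η E') →
      ∃ θ, Unifies θ E ∧ ∀ η, Unifies η E → ∃ ρ, ∀ y, η y = (θ y).subst ρ := by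
    intro x t E' h1 h2 h3 h4
    by_cases hx : x ∈ t.varFinset
    -- Since a unifier exists, the occurs check can fail only for the trivial equation `x = x`.
    · obtain rfl := var_eq_of_subst_eq hx ((h4 η₀).1 hE).1
      have h5 : ∀ η, Unifies η E ↔ Unifies η E' := fun η => by rw [h4]; simp [tvar]
      simp only [h5]
      exact ih2 E' h2 h3 ((h5 _).1 hE)
    · obtain ⟨θ, h5, h6⟩ := exists_mgu_eliminate hx ((h4 η₀).1 hE).1 ((h4 η₀).1 hE).2 (h1 ▸ ih1)
      exact ⟨θ, (h4 θ).2 h5, fun η hη => h6 η ((h4 η).1 hη).1 ((h4 η).1 hη).2⟩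
  match E with
  | [] => exact ⟨tvar, by simp [Unifies], fun η _ => ⟨η, fun y => rfl⟩⟩
  | (.var x, t) :: E' =>
    refine elim x t E' ?_ ?_ ?_ ?_
    · ext; simp [eqVars]
    · exact Finset.subset_union_right
    · have := one_le_tsize t
      rw [eqSize_cons]; simp only; omega
    · intro η; simp [Unifies]
  | (.func f ts, .var x) :: E' =>
    refine elim x (.func f ts) E' ?_ ?_ ?_ ?_
    · ext; simp only [eqVars, Term.varFinset, Finset.mem_union, Finset.mem_insert, Finset.mem_singleton]; tauto
    · exact Finset.subset_union_right
    · have := one_le_tsize (.func f ts)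
      rw [eqSize_cons]; simp only; omega
    · intro η; simp [Unifies, eq_comm]
  | (.func (l := k) f ts, .func (l := k') g us) :: E' =>
    -- The unifier `η₀` rules out a clash of head symbols.
    have h0 := hE _ (List.mem_cons_self ..)
    simp only [Term.subst, Term.func.injEq] at h0
    obtain ⟨rfl, h0, -⟩ := h0
    obtain rfl := eq_of_heq h0
    have h4 : ∀ η, Unifies η ((.func f ts, .func f us) :: E') ↔
        Unifies η ((List.ofFn fun i => (ts i, us i)) ++ E') := by
      intro η
      simp [Unifies, funext_iff, or_imp, forall_and]
    simp only [h4]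
    refine ih2 _ ?_ ?_ ((h4 _).1 hE)
    · intro x hx
      obtain ⟨e, he, hx⟩ := mem_eqVars.1 hx
      rcases List.mem_append.1 he with he | he
      · obtain ⟨i, rfl⟩ := (List.mem_ofFn' ..).1 he
        refine mem_eqVars.2 ⟨_, List.mem_cons_self .., ?_⟩
        simp only [Term.varFinset, Finset.mem_biUnion, Finset.mem_univ, true_and]
        exact hx.imp (fun h => ⟨i, h⟩) (fun h => ⟨i, h⟩)
      · exact mem_eqVars.2 ⟨e, List.mem_cons_of_mem _ he, hx⟩
    · rw [eqSize_cons]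
      simp only [eqSize, List.map_append, List.map_ofFn, List.sum_append, List.sum_ofFn, tsize]
      simp only [Function.comp_def, Finset.sum_add_distrib]
      omega

theorem exists_mgu {t u : Tm} {η : ℕ → Tm} (h : t.subst η = u.subst η) : ∃ θ, IsMGU θ t u := by
  obtain ⟨θ, h1, h2⟩ := exists_mgu_list [(t, u)] η (by simpa [Unifies] using h)
  exact ⟨θ, by simpa [Unifies] using h1, fun η' h' => h2 η' (by simpa [Unifies] using h')⟩

/-! ### The relation denoted by a wiring -/

/-- The pairs of terms that are instances of a flow. -/
def flowRel (f : Flow) (s t : Tm) : Prop :=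
  ∃ a : RawFlow, a.toFlow = f ∧ ∃ η : ℕ → Tm, s = a.head.subst η ∧ t = a.body.subst η

/-- The pairs of terms that are instances of a flow of a wiring. -/
def wiringRel (F : Set Flow) (s t : Tm) : Prop := ∃ f ∈ F, flowRel f s t

theorem toFlow_eq_iff {a b : RawFlow} :
    a.toFlow = b.toFlow ↔ ∃ α : Equiv.Perm ℕ, b.head = a.head.relabel α ∧ b.body = a.body.relabel α :=
  Quotient.eq (r := flowSetoid)

theorem flowRel_toFlow {a : RawFlow} {s t : Tm} :
    flowRel a.toFlow s t ↔ ∃ η : ℕ → Tm, s = a.head.subst η ∧ t = a.body.subst η := by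
  constructor
  · rintro ⟨b, hb, η, rfl, rfl⟩
    obtain ⟨α, h1, h2⟩ := toFlow_eq_iff.1 hb
    refine ⟨fun x => η (α.symm x), ?_, ?_⟩ <;> simp [h1, h2, subst_relabel]
  · rintro ⟨η, h⟩
    exact ⟨a, rfl, η, h⟩

theorem exists_disjoint_rep (f : Flow) (V : Finset ℕ) : ∃ b : RawFlow, b.toFlow = f ∧ Disjoint V b.vars := by
  obtain ⟨a, rfl⟩ := Quotient.exists_rep f
  obtain ⟨N, hN⟩ : ∃ N, ∀ x ∈ V ∪ a.vars, x < N :=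
    ⟨(V ∪ a.vars).sup id + 1, fun x hx => Nat.lt_succ_of_le (Finset.le_sup (f := id) hx)⟩
  -- A renaming has to be a permutation of all the variables: this one exchanges the blocks `[0, N)`
  -- and `[N, 2N)`.
  let α : Equiv.Perm ℕ :=
    { toFun := fun x => if x < N then x + N else if x < 2 * N then x - N else x
      invFun := fun x => if x < N then x + N else if x < 2 * N then x - N else x
      left_inv := fun x => by simp only; split_ifs <;> omega
      right_inv := fun x => by simp only; split_ifs <;> omega }
  refine ⟨⟨a.head.relabel α, a.body.relabel α, ?_⟩, (toFlow_eq_iff.2 ⟨α, rfl, rfl⟩).symm, ?_⟩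
  · rw [varFinset_relabel, varFinset_relabel]
    exact Finset.image_subset_image a.vars_subset
  · rw [Finset.disjoint_left]
    intro x hx hx'
    simp only [RawFlow.vars, varFinset_relabel, Finset.mem_image] at hx'
    obtain ⟨y, hy, rfl⟩ := hx'
    have h1 := hN y (Finset.mem_union_right _ hy)
    have h2 := hN _ (Finset.mem_union_left _ hx)
    simp only [α, Equiv.coe_fn_mk, h1, if_true] at h2
    omega

theorem subst_glue {a b : RawFlow} (hd : Disjoint a.vars b.vars) (η₁ η₂ : ℕ → Tm) :
    ∃ η : ℕ → Tm, a.head.subst η = a.head.subst η₁ ∧ a.body.subst η = a.body.subst η₁ ∧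
      b.head.subst η = b.head.subst η₂ ∧ b.body.subst η = b.body.subst η₂ := by
  classical
  refine ⟨fun x => if x ∈ a.vars then η₁ x else η₂ x, ?_, ?_, ?_, ?_⟩ <;>
    refine subst_congr fun x hx => ?_
  · exact if_pos (a.vars_subset hx)
  · exact if_pos hx
  · exact if_neg fun h => Finset.disjoint_left.1 hd h (b.vars_subset hx)
  · exact if_neg fun h => Finset.disjoint_left.1 hd h hx

/-- Two instances that share their middle term glue, the variables being disjoint, to one unifier of
the middle terms. It factors through `θ`, hence is an instance of the resolvent. -/
theorem flowRel_of_isProduct {f g h : Flow} (H : IsProduct f g h) (s t : Tm) :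
    flowRel h s t ↔ ∃ r, flowRel f s r ∧ flowRel g r t := by
  obtain ⟨a, b, rfl, rfl, hd, θ, hθ, rfl⟩ := H
  simp only [flowRel_toFlow]
  constructor
  · rintro ⟨η, rfl, rfl⟩
    refine ⟨(a.body.subst θ).subst η, ⟨fun x => (θ x).subst η, ?_, ?_⟩, ⟨fun x => (θ x).subst η, ?_, ?_⟩⟩
    · simp [RawFlow.resolvent, subst_subst]
    · simp [subst_subst]
    · rw [hθ.1, subst_subst]
    · simp [RawFlow.resolvent, subst_subst]
  · rintro ⟨r, ⟨η₁, rfl, rfl⟩, ⟨η₂, h1, rfl⟩⟩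
    obtain ⟨η, e1, e2, e3, e4⟩ := subst_glue hd η₁ η₂
    obtain ⟨ρ, hρ⟩ := hθ.2 η (by rw [e2, e3, h1])
    obtain rfl : η = fun x => (θ x).subst ρ := funext hρ
    refine ⟨ρ, ?_, ?_⟩
    · simp [RawFlow.resolvent, subst_subst, e1]
    · simp [RawFlow.resolvent, subst_subst, e4]

theorem exists_isProduct {f g : Flow} {s r t : Tm} (hf : flowRel f s r) (hg : flowRel g r t) :
    ∃ h, IsProduct f g h := by
  obtain ⟨a, rfl, η₁, rfl, rfl⟩ := hf
  obtain ⟨b, rfl, hd⟩ := exists_disjoint_rep g a.vars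
  obtain ⟨η₂, h1, rfl⟩ := flowRel_toFlow.1 hg
  obtain ⟨η, e1, e2, e3, e4⟩ := subst_glue hd η₁ η₂
  obtain ⟨θ, hθ⟩ := exists_mgu (t := a.body) (u := b.head) (η := η) (by rw [e2, e3, h1])
  exact ⟨_, a, b, rfl, rfl, hd, θ, hθ, rfl⟩

theorem wiringRel_wmul (F G : Set Flow) (s t : Tm) :
    wiringRel (wmul F G) s t ↔ ∃ r, wiringRel F s r ∧ wiringRel G r t := by
  constructor
  · rintro ⟨h, ⟨f, hf, g, hg, hp⟩, hst⟩
    obtain ⟨r, h1, h2⟩ := (flowRel_of_isProduct hp s t).1 hst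
    exact ⟨r, ⟨f, hf, h1⟩, ⟨g, hg, h2⟩⟩
  · rintro ⟨r, ⟨f, hf, h1⟩, ⟨g, hg, h2⟩⟩
    obtain ⟨h, hp⟩ := exists_isProduct h1 h2
    exact ⟨h, ⟨f, hf, g, hg, hp⟩, (flowRel_of_isProduct hp s t).2 ⟨r, h1, h2⟩⟩

/-- Every flow has an instance, for example itself under the identity substitution, so the relation
detects emptiness. -/
theorem eq_empty_iff_wiringRel (F : Set Flow) : F = ∅ ↔ ∀ s t, ¬ wiringRel F s t := by
  constructor
  · rintro rfl s t ⟨f, hf, -⟩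
    exact hf
  · intro h
    refine Set.eq_empty_of_forall_notMem fun f hf => ?_
    obtain ⟨a, rfl⟩ := Quotient.exists_rep f
    exact h _ _ ⟨_, hf, a, rfl, tvar, rfl, rfl⟩

theorem wiringRel_wone (s t : Tm) : wiringRel wone s t ↔ s = t := by
  constructor
  · rintro ⟨f, rfl, h⟩
    obtain ⟨η, rfl, rfl⟩ := flowRel_toFlow.1 h
    rfl
  · rintro rfl
    exact ⟨_, rfl, flowRel_toFlow.2 ⟨fun _ => s, rfl, rfl⟩⟩

/-! ### Paths -/

/-- `g 0, …, g n` is a path of the relation `R`. -/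
def IsPath {X : Type*} (R : X → X → Prop) (n : ℕ) (g : ℕ → X) : Prop := ∀ i < n, R (g i) (g (i + 1))

/-- The relation `R` has paths of every length. -/
def LongPaths {X : Type*} (R : X → X → Prop) : Prop := ∀ n, ∃ g, IsPath R n g

theorem wiringRel_wpow (F : Set Flow) (n : ℕ) (s t : Tm) :
    wiringRel (wpow F n) s t ↔ ∃ g, IsPath (wiringRel F) n g ∧ g 0 = s ∧ g n = t := by
  induction n generalizing t with
  | zero =>
    rw [wpow, wiringRel_wone]
    constructor
    · rintro rfl
      exact ⟨fun _ => s, by simp [IsPath], rfl, rfl⟩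
    · rintro ⟨g, -, rfl, rfl⟩
      rfl
  | succ n ih =>
    rw [wpow, wiringRel_wmul]
    constructor
    · rintro ⟨r, h1, h2⟩
      obtain ⟨g, hg, rfl, rfl⟩ := (ih r).1 h1
      refine ⟨fun i => if i ≤ n then g i else t, fun i hi => ?_, by simp, by simp⟩
      rcases Nat.lt_or_ge i n with h | h
      · simpa [h.le, Nat.succ_le_of_lt h] using hg i h
      · obtain rfl : i = n := by omega
        simpa using h2
    · rintro ⟨g, hg, rfl, rfl⟩
      exact ⟨g n, (ih _).2 ⟨g, fun i hi => hg i (by omega), rfl, rfl⟩, hg n (by omega)⟩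

/-- From here on unification plays no role: wirings are compared by mapping paths to paths. -/
theorem nilpotent_iff (F : Set Flow) : Nilpotent F ↔ ¬ LongPaths (wiringRel F) := by
  simp only [Nilpotent, LongPaths, not_forall, eq_empty_iff_wiringRel, wiringRel_wpow]
  refine exists_congr fun n => ?_
  simp only [not_exists, not_and]
  exact ⟨fun h g hg => h _ _ g hg rfl rfl, fun h s t g hg _ _ => h g hg⟩

theorem LongPaths.map {X Y : Type*} {R : X → X → Prop} {S : Y → Y → Prop} (φ : X → Y)
    (h : ∀ x y, R x y → S (φ x) (φ y)) (hR : LongPaths R) : LongPaths S := fun n => by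
  obtain ⟨g, hg⟩ := hR n
  exact ⟨φ ∘ g, fun i hi => h _ _ (hg i hi)⟩

/-- Related points of `S` all lie in the image of `φ`, so a left inverse of `φ` carries paths back.
-/
theorem longPaths_congr {X Y : Type*} [Nonempty X] {R : X → X → Prop} {S : Y → Y → Prop} {φ : X → Y}
    (hφ : Function.Injective φ) (h : ∀ a b, S a b ↔ ∃ x y, a = φ x ∧ b = φ y ∧ R x y) :
    LongPaths S ↔ LongPaths R := by
  refine ⟨LongPaths.map (Function.invFun φ) fun a b hab => ?_, LongPaths.map φ fun x y hxy =>
    (h _ _).2 ⟨x, y, rfl, rfl, hxy⟩⟩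
  obtain ⟨x, y, rfl, rfl, hxy⟩ := (h a b).1 hab
  rwa [Function.leftInverse_invFun hφ, Function.leftInverse_invFun hφ]

/-- The relation that alternates between `R` and `S`. -/
def alternate {X : Type*} (R S : X → X → Prop) (x y : Bool × X) : Prop :=
  y.1 = !x.1 ∧ (bif x.1 then S x.2 y.2 else R x.2 y.2)

/-- Alternating paths are about twice as long as paths of the composite, which does not affect
whether lengths are bounded. This allows the two factors of a product to be coded by separate flows.
-/
theorem longPaths_alternate {X : Type*} (R S : X → X → Prop) :
    LongPaths (alternate R S) ↔ LongPaths fun x z => ∃ y, R x y ∧ S y z := by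
  constructor
  · intro h n
    -- The additional step can be discarded when the path starts in the wrong phase; `d` below is
    -- the number of steps discarded.
    obtain ⟨g, hg⟩ := h (2 * n + 1)
    have key : ∀ d ≤ 1, (g d).1 = false → ∃ g', IsPath (fun x z => ∃ y, R x y ∧ S y z) n g' := by
      intro d hd h0
      have h1 : ∀ i, i ≤ n → (g (2 * i + d)).1 = false := by
        intro i
        induction i with
        | zero => intro _; simpa using h0
        | succ i ih =>
          intro hi
          have e1 := (hg (2 * i + d) (by omega)).1
          have e2 := (hg (2 * i + d + 1) (by omega)).1
          rw [show 2 * (i + 1) + d = 2 * i + d + 1 + 1 by ring, e2, e1, ih (by omega)]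
          rfl
      refine ⟨fun i => (g (2 * i + d)).2, fun i hi => ⟨(g (2 * i + d + 1)).2, ?_, ?_⟩⟩
      · have := (hg (2 * i + d) (by omega)).2
        simpa [h1 i hi.le] using this
      · have e1 := (hg (2 * i + d) (by omega)).1
        have := (hg (2 * i + d + 1) (by omega)).2
        rw [e1, h1 i hi.le] at this
        simpa [show 2 * (i + 1) + d = 2 * i + d + 1 + 1 by ring] using this
    cases h0 : (g 0).1
    · exact key 0 (by omega) h0
    · exact key 1 le_rfl (by rw [(hg 0 (by omega)).1, h0]; rfl)
  · intro h n
    obtain ⟨g, hg⟩ := h n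
    have : Nonempty X := ⟨g 0⟩
    choose! m hm using hg
    -- Even indices carry the points of the given path, odd indices the intermediate points.
    refine ⟨fun i => (i % 2 = 1, if i % 2 = 1 then m (i / 2) else g (i / 2)), fun i hi => ?_⟩
    rcases Nat.mod_two_eq_zero_or_one i with h | h
    · have e1 : (i + 1) % 2 = 1 := by omega
      have e2 : (i + 1) / 2 = i / 2 := by omega
      simp [alternate, h, e1, e2, (hm (i / 2) (by omega)).1]
    · have e1 : (i + 1) % 2 = 0 := by omega
      have e2 : (i + 1) / 2 = i / 2 + 1 := by omega
      simp [alternate, h, e1, e2, (hm (i / 2) (by omega)).2]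

open Computability Turing

/-! ### A machine that prints one string for every tuple of positions of its input

The instructions of a printing program are either to print a symbol or to print the `j`-th
component of the current tuple in unary. -/

namespace Printer

/-- Print a symbol, or the `j`-th position in unary. -/
abbrev Instr (K : ℕ) : Type := Γ' ⊕ Fin (K + 1)

/-- The string printed by an instruction for the tuple of positions `v`. -/
def Instr.out {K : ℕ} (v : ℕ → ℕ) : Instr K → List Γ'
  | .inl γ => [γ]
  | .inr j => List.replicate (v j) (Γ'.bit true)

/-- The stacks: input, output, an auxiliary stack and, for every component of the tuple, the letters
before and after the position. -/
inductive Stk (K : ℕ) : Type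
  | inp
  | out
  | tmp
  | pre (j : Fin (K + 1))
  | post (j : Fin (K + 1))
  deriving DecidableEq, Fintype

/-- The alphabets of the stacks. -/
abbrev Sym (A : Type) {K : ℕ} : Stk K → Type
  | .inp => A
  | .out => Γ'
  | .tmp => Option A
  | .pre _ => Option A
  | .post _ => Option A

/-- The labels of the machine; `Q` is the type of printing programs. -/
inductive Lab (K : ℕ) (Q : Type) : Type
  | rev
  | fill
  | body
  | exec (q : Q)
  | copy (j : Fin (K + 1)) (q : Q)
  | back (j : Fin (K + 1)) (q : Q)
  | next (j : Fin (K + 1))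
  | reset (j : Fin (K + 1))
  | clean
  deriving Fintype

/-- The printing programs of bounded length. -/
abbrev Code (K M : ℕ) : Type := {q : List (Instr K) // q.length ≤ M}

noncomputable instance (K M : ℕ) : Fintype (Code K M) := (List.finite_length_le (Instr K) M).fintype

/-- The registers of the machine. -/
abbrev Reg (A : Type) : Type := Option A × Option A

section
variable {A : Type} {K M : ℕ}

/-- The statements of the machine. -/
abbrev St (A : Type) (K M : ℕ) : Type := TM2.Stmt (Sym A (K := K)) (Lab K (Code K M)) (Reg A)

open TM2.Stmt

/-- What follows the treatment of the components `< j` of the tuple. -/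
def nextLab (Q : Type) (j : ℕ) : Lab K Q := if h : j < K + 1 then .next ⟨j, h⟩ else .clean

/-- The machine. -/
def prog (p : Option A → Option A → Code K M) : Lab K (Code K M) → St A K M
  | .rev => pop .inp (fun _ a => (a, none)) <| branch (fun s => s.1.isSome)
      (push .tmp (fun s => s.1) <| goto fun _ => .rev) (goto fun _ => .fill)
  | .fill => pop .tmp (fun _ a => (a.join, none)) <| branch (fun s => s.1.isSome)
      ((List.finRange (K + 1)).foldr (fun j q => push (.post j) (fun s => s.1) q)
        (goto fun _ => .fill)) (goto fun _ => .body)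
  | .body => peek (.pre 0) (fun _ a => (a.join, none)) <|
      peek (.post 0) (fun s a => (s.1, a.join)) <| goto fun s => .exec (p s.1 s.2)
  | .exec ⟨[], _⟩ => goto fun _ => nextLab _ 0
  | .exec ⟨.inl γ :: q, h⟩ => push .out (fun _ => γ) <| goto fun _ => .exec ⟨q, (Nat.le_succ _).trans h⟩
  | .exec ⟨.inr j :: q, h⟩ => goto fun _ => .copy j ⟨q, (Nat.le_succ _).trans h⟩
  | .copy j q => pop (.pre j) (fun _ a => (a.join, none)) <| branch (fun s => s.1.isSome)
      (push .tmp (fun s => s.1) <| push .out (fun _ => Γ'.bit true) <| goto fun _ => .copy j q)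
      (goto fun _ => .back j q)
  | .back j q => pop .tmp (fun _ a => (a.join, none)) <| branch (fun s => s.1.isSome)
      (push (.pre j) (fun s => s.1) <| goto fun _ => .back j q) (goto fun _ => .exec q)
  | .next j => pop (.post j) (fun _ a => (a.join, none)) <| branch (fun s => s.1.isSome)
      (push (.pre j) (fun s => s.1) <| goto fun _ => .body) (goto fun _ => .reset j)
  | .reset j => pop (.pre j) (fun _ a => (a.join, none)) <| branch (fun s => s.1.isSome)
      (push (.post j) (fun s => s.1) <| goto fun _ => .reset j) (goto fun _ => nextLab _ (j + 1))
  | .clean => (List.finRange (K + 1)).foldr (fun j q => pop (.post j) (fun _ a => (a.join, none)) q) <|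
      branch (fun s => s.1.isSome) (goto fun _ => .clean) (load (fun _ => (none, none)) halt)

/-- The contents of the stacks. -/
def stk (i : List A) (o : List Γ') (t : List (Option A)) (P Q : Fin (K + 1) → List (Option A)) :
    ∀ k : Stk K, List (Sym A k)
  | .inp => i
  | .out => o
  | .tmp => t
  | .pre j => P j
  | .post j => Q j

section
variable (i : List A) (o : List Γ') (t : List (Option A)) (P Q : Fin (K + 1) → List (Option A))

@[simp] theorem stk_inp : stk i o t P Q .inp = i := rfl
@[simp] theorem stk_out : stk i o t P Q .out = o := rfl
@[simp] theorem stk_tmp : stk i o t P Q .tmp = t := rfl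
@[simp] theorem stk_pre (j : Fin (K + 1)) : stk i o t P Q (.pre j) = P j := rfl
@[simp] theorem stk_post (j : Fin (K + 1)) : stk i o t P Q (.post j) = Q j := rfl

@[simp] theorem update_inp (x : List A) :
    Function.update (stk i o t P Q) .inp x = stk x o t P Q := by
  funext k; cases k <;> simp [Function.update, stk]

@[simp] theorem update_out (x : List Γ') :
    Function.update (stk i o t P Q) .out x = stk i x t P Q := by
  funext k; cases k <;> simp [Function.update, stk]

@[simp] theorem update_tmp (x : List (Option A)) :
    Function.update (stk i o t P Q) .tmp x = stk i o x P Q := by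
  funext k; cases k <;> simp [Function.update, stk]

@[simp] theorem update_pre (j : Fin (K + 1)) (x : List (Option A)) :
    Function.update (stk i o t P Q) (.pre j) x = stk i o t (Function.update P j x) Q := by
  funext k
  cases k with
  | pre j' => by_cases h : j' = j
              · subst h; simp [stk]
              · rw [Function.update_of_ne (by simpa using h)]; simp [stk, h]
  | _ => simp [Function.update, stk]

@[simp] theorem update_post (j : Fin (K + 1)) (x : List (Option A)) :
    Function.update (stk i o t P Q) (.post j) x = stk i o t P (Function.update Q j x) := by
  funext k
  cases k with
  | post j' => by_cases h : j' = j
               · subst h; simp [stk]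
               · rw [Function.update_of_ne (by simpa using h)]; simp [stk, h]
  | _ => simp [Function.update, stk]

end

/-- The machine goes from `l` to `l'` in at most `n` steps, whatever the registers are. -/
def Go (p : Option A → Option A → Code K M) (n : ℕ) (l : Lab K (Code K M)) (S : ∀ k : Stk K, List (Sym A k))
    (l' : Lab K (Code K M)) (S' : ∀ k : Stk K, List (Sym A k)) : Prop :=
  ∀ s : Reg A, ∃ s' : Reg A, ∃ k ≤ n,
    (flip bind (TM2.step (prog p)))^[k] (some ⟨some l, s, S⟩) = some ⟨some l', s', S'⟩

variable {p : Option A → Option A → Code K M}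

theorem Go.trans {m n : ℕ} {l l' l'' : Lab K (Code K M)} {S S' S'' : ∀ k : Stk K, List (Sym A k)}
    (h : Go p m l S l' S') (h' : Go p n l' S' l'' S'') : Go p (m + n) l S l'' S'' := by
  intro s
  obtain ⟨s', k, hk, e⟩ := h s
  obtain ⟨s'', k', hk', e'⟩ := h' s'
  exact ⟨s'', k' + k, by omega, by rw [Function.iterate_add_apply, e, e']⟩

theorem Go.mono {m n : ℕ} {l l' : Lab K (Code K M)} {S S' : ∀ k : Stk K, List (Sym A k)}
    (h : Go p m l S l' S') (hmn : m ≤ n) : Go p n l S l' S' := by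
  intro s
  obtain ⟨s', k, hk, e⟩ := h s
  exact ⟨s', k, hk.trans hmn, e⟩

theorem Go.single {l l' : Lab K (Code K M)} {S S' : ∀ k : Stk K, List (Sym A k)}
    (h : ∀ s, (TM2.stepAux (prog p l) s S).l = some l' ∧ (TM2.stepAux (prog p l) s S).stk = S') :
    Go p 1 l S l' S' := by
  intro s
  refine ⟨(TM2.stepAux (prog p l) s S).var, 1, le_rfl, ?_⟩
  simp [flip, ← (h s).1, ← (h s).2]

theorem go_rev (W : List A) (t : List (Option A)) :
    Go p (W.length + 1) .rev (stk W [] t (fun _ => []) fun _ => []) .fill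
      (stk [] [] ((W.map some).reverse ++ t) (fun _ => []) fun _ => []) := by
  induction W generalizing t with
  | nil => exact Go.single fun s => by simp [prog]
  | cons a W ih =>
    have h1 : Go p 1 .rev (stk (a :: W) [] t (fun _ => []) fun _ => []) .rev
        (stk W [] (some a :: t) (fun _ => []) fun _ => []) := Go.single fun s => by simp [prog]
    simpa using (h1.trans (ih _)).mono (show _ ≤ (a :: W).length + 1 by simp; omega)

/-- A step of the machine runs a whole statement up to its next jump, so the letter reaches all the
zippers within one step. -/
theorem stepAux_push_post (q : St A K M) (s : Reg A) (i : List A) (o : List Γ') (t : List (Option A))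
    (P Q : Fin (K + 1) → List (Option A)) (J : List (Fin (K + 1))) (hJ : J.Nodup) :
    TM2.stepAux (J.foldr (fun j q => push (.post j) (fun s => s.1) q) q) s (stk i o t P Q) =
      TM2.stepAux q s (stk i o t P fun j => if j ∈ J then s.1 :: Q j else Q j) := by
  induction J generalizing Q with
  | nil => simp
  | cons j J ih =>
    obtain ⟨hj, hJ⟩ := List.nodup_cons.1 hJ
    simp only [List.foldr_cons, TM2.stepAux, stk_post, update_post, ih _ hJ]
    congr 2
    funext j'
    by_cases h : j' = j
    · subst h; simp [hj]
    · simp [h]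

/-- The stacks being popped have equal contents, so whichever is popped last leaves the same letter
in the register. -/
theorem stepAux_pop_post (q : St A K M) (s : Reg A) (i : List A) (o : List Γ') (t : List (Option A))
    (P Q : Fin (K + 1) → List (Option A)) (x : List (Option A)) (J : List (Fin (K + 1)))
    (hJ : J.Nodup) (hQ : ∀ j ∈ J, Q j = x) :
    TM2.stepAux (J.foldr (fun j (q : St A K M) =>
        pop (.post j) (fun (_ : Reg A) (a : Option (Option A)) => (a.join, none)) q) q) s
        (stk i o t P Q) =
      TM2.stepAux q (if J = [] then s else (x.head?.join, none))
        (stk i o t P fun j => if j ∈ J then x.tail else Q j) := by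
  induction J generalizing Q s with
  | nil => simp
  | cons j J ih =>
    obtain ⟨hj, hJ⟩ := List.nodup_cons.1 hJ
    have e : ∀ j' ∈ J, Function.update Q j (Q j).tail j' = x := fun j' h' => by
      rw [Function.update_of_ne (by rintro rfl; exact hj h')]
      exact hQ _ (List.mem_cons_of_mem _ h')
    simp only [List.foldr_cons, TM2.stepAux, stk_post, update_post, ih _ _ hJ e]
    rw [hQ j (List.mem_cons_self ..)]
    congr 1
    · simp
    · congr 1
      funext j'
      by_cases h : j' = j
      · subst h; simp [hj]
      · simp [h]

theorem go_fill (W : List A) (X : List (Option A)) :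
    Go p (W.length + 1) .fill (stk [] [] (W.map some) (fun _ => []) fun _ => X) .body
      (stk [] [] [] (fun _ => []) fun _ => (W.map some).reverse ++ X) := by
  induction W generalizing X with
  | nil => exact Go.single fun s => by simp [prog]
  | cons a W ih =>
    have h1 : Go p 1 .fill (stk [] [] ((a :: W).map some) (fun _ => []) fun _ => X) .fill
        (stk [] [] (W.map some) (fun _ => []) fun _ => some a :: X) :=
      Go.single fun s => by
        simp [prog, stepAux_push_post _ _ _ _ _ _ _ _ (List.nodup_finRange (K + 1))]
    simpa using (h1.trans (ih _)).mono (show _ ≤ (a :: W).length + 1 by simp; omega)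

/-- This phase is not expressed by `Go`: it ends without a label, and a halting configuration must
have its registers restored to their initial value. -/
theorem iterate_clean (n : ℕ) (X : List A) (hX : X.length = n) (o : List Γ') (s : Reg A) :
    ∃ k ≤ n + 1, (flip bind (TM2.step (prog p)))^[k]
      (some ⟨some .clean, s, stk [] o [] (fun _ => []) fun _ => X.map some⟩) =
      some ⟨none, (none, none), stk [] o [] (fun _ => []) fun _ => []⟩ := by
  induction n generalizing X s with
  | zero =>
    obtain rfl := List.length_eq_zero_iff.1 hX
    refine ⟨1, by simp, ?_⟩
    simp [flip, prog, stepAux_pop_post _ _ _ _ _ _ _ [] _ (List.nodup_finRange (K + 1))]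
  | succ n ih =>
    obtain ⟨a, X, rfl⟩ := List.exists_cons_of_length_eq_add_one hX
    obtain ⟨k, hk, e⟩ := ih X (by simpa using hX) (some a, none)
    refine ⟨k + 1, by omega, ?_⟩
    rw [Function.iterate_succ_apply]
    convert e using 2
    simp [flip, prog, stepAux_pop_post _ _ _ _ _ _ _ (some a :: X.map some) _ (List.nodup_finRange (K + 1))]

/-- The height of the stack `pre j` is the `j`-th position, so emptying it while printing one bit
per letter writes that position in unary. The letters are kept on `tmp` for `go_back`. -/
theorem go_copy (j : Fin (K + 1)) (q : Code K M) (X : List A) (o : List Γ') (t : List (Option A))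
    (P Q : Fin (K + 1) → List (Option A)) (hX : P j = X.map some) :
    Go p (X.length + 1) (.copy j q) (stk [] o t P Q) (.back j q)
      (stk [] (List.replicate X.length (Γ'.bit true) ++ o) ((X.map some).reverse ++ t)
        (Function.update P j []) Q) := by
  induction X generalizing o t P with
  | nil => exact Go.single fun s => by simp [prog, hX]
  | cons a X ih =>
    have h1 : Go p 1 (.copy j q) (stk [] o t P Q) (.copy j q)
        (stk [] (Γ'.bit true :: o) (some a :: t) (Function.update P j (X.map some)) Q) :=
      Go.single fun s => by simp [prog, hX]
    have := (h1.trans (ih _ _ _ (by simp))).mono (show _ ≤ (a :: X).length + 1 by simp; omega)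
    simpa [List.replicate_succ', Function.update_idem] using this

theorem go_back (j : Fin (K + 1)) (q : Code K M) (X : List A) (o : List Γ')
    (P Q : Fin (K + 1) → List (Option A)) :
    Go p (X.length + 1) (.back j q) (stk [] o (X.map some) P Q) (.exec q)
      (stk [] o [] (Function.update P j ((X.map some).reverse ++ P j)) Q) := by
  induction X generalizing P with
  | nil => exact Go.single fun s => by simp [prog]
  | cons a X ih =>
    have h1 : Go p 1 (.back j q) (stk [] o ((a :: X).map some) P Q) (.back j q)
        (stk [] o (X.map some) (Function.update P j (some a :: P j)) Q) :=
      Go.single fun s => by simp [prog]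
    have := (h1.trans (ih _)).mono (show _ ≤ (a :: X).length + 1 by simp; omega)
    simpa [Function.update_idem] using this

theorem go_reset (j : Fin (K + 1)) (X : List A) (o : List Γ')
    (P Q : Fin (K + 1) → List (Option A)) (hX : P j = X.map some) :
    Go p (X.length + 1) (.reset j) (stk [] o [] P Q) (nextLab _ (j + 1))
      (stk [] o [] (Function.update P j []) (Function.update Q j ((X.map some).reverse ++ Q j))) := by
  induction X generalizing P Q with
  | nil => exact Go.single fun s => by simp [prog, hX]
  | cons a X ih =>
    have h1 : Go p 1 (.reset j) (stk [] o [] P Q) (.reset j)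
        (stk [] o [] (Function.update P j (X.map some)) (Function.update Q j (some a :: Q j))) :=
      Go.single fun s => by simp [prog, hX]
    have := (h1.trans (ih _ _ (by simp))).mono (show _ ≤ (a :: X).length + 1 by simp; omega)
    simpa [Function.update_idem] using this

/-- The stacks when the current tuple of positions of the word `W` is `v`. -/
def zip (W : List A) (v : ℕ → ℕ) (o : List Γ') : ∀ k : Stk K, List (Sym A k) :=
  stk [] o [] (fun j => ((W.take (v j)).map some).reverse) fun j => (W.drop (v j)).map some

/-- An instruction costs at most one step to decode and two passes of at most `W.length + 1` steps,
out and back. As the output is a stack, what is printed last comes first; hence the reversal of `q`.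
-/
theorem go_exec (W : List A) (v : ℕ → ℕ) (hv : ∀ j, v j ≤ W.length) (o : List Γ')
    (q : List (Instr K)) (hq : q.length ≤ M) :
    Go p (q.length * (2 * W.length + 3) + 1) (.exec ⟨q, hq⟩) (zip W v o) (nextLab _ 0)
      (zip W v (q.reverse.flatMap (Instr.out v) ++ o)) := by
  induction q generalizing o with
  | nil =>
    have h1 : Go p 1 (.exec ⟨[], hq⟩) (zip W v o) (nextLab _ 0) (zip W v o) :=
      Go.single fun s => by simp [prog]
    simpa using h1
  | cons a q ih =>
    rcases a with γ | j
    · have h1 : Go p 1 (.exec ⟨.inl γ :: q, hq⟩) (zip W v o) (.exec ⟨q, (Nat.le_succ _).trans hq⟩)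
          (zip W v (γ :: o)) := Go.single fun s => by simp [prog, zip]
      have := (h1.trans (ih _ _)).mono (show _ ≤ (q.length + 1) * (2 * W.length + 3) + 1 by
        rw [Nat.add_mul]; omega)
      simpa [Instr.out] using this
    · have h1 : Go p 1 (.exec ⟨.inr j :: q, hq⟩) (zip W v o)
          (.copy j ⟨q, (Nat.le_succ _).trans hq⟩) (zip W v o) := Go.single fun s => by simp [prog, zip]
      have h2 := go_copy (p := p) j ⟨q, (Nat.le_succ _).trans hq⟩ (W.take (v j)).reverse o []
        (fun j : Fin (K + 1) => ((W.take (v j)).map some).reverse) (fun j => (W.drop (v j)).map some)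
            (by simp)
      have h3 := go_back (p := p) j ⟨q, (Nat.le_succ _).trans hq⟩ (W.take (v j))
        (List.replicate (v j) (Γ'.bit true) ++ o)
        (Function.update (fun j : Fin (K + 1) => ((W.take (v j)).map some).reverse) j [])
        (fun j => (W.drop (v j)).map some)
      have e : Function.update (fun j : Fin (K + 1) => ((W.take (v j)).map some).reverse) j
          ((W.take (v j)).map some).reverse =
          fun j : Fin (K + 1) => ((W.take (v j)).map some).reverse :=
        Function.update_eq_self ..
      simp only [List.length_reverse, List.length_take, min_eq_left (hv j), List.map_reverse,
        List.reverse_reverse, List.append_nil, Function.update_self, Function.update_idem, e]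
        at h2 h3
      have h4 := ((h1.trans h2).trans h3).trans (ih (List.replicate (v j) (Γ'.bit true) ++ o)
        ((Nat.le_succ _).trans hq))
      have := h4.mono (show _ ≤ (q.length + 1) * (2 * W.length + 3) + 1 by
        have := hv j
        rw [Nat.add_mul]; omega)
      simpa [Instr.out] using this

/-- The string printed for the tuple `v`. -/
def outAt (p : Option A → Option A → Code K M) (W : List A) (v : ℕ → ℕ) : List Γ' :=
  (p (W.take (v 0)).getLast? W[v 0]?).1.reverse.flatMap (Instr.out v)

/-- The tuples of positions `≤ n` that agree with `v` from the component `j` on. -/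
def tuples (n : ℕ) : ℕ → (ℕ → ℕ) → List (ℕ → ℕ)
  | 0, v => [v]
  | j + 1, v => (List.range (n + 1)).reverse.flatMap fun a => tuples n j (Function.update v j a)

theorem mem_tuples {n j : ℕ} {v w : ℕ → ℕ} :
    w ∈ tuples n j v ↔ (∀ i < j, w i ≤ n) ∧ ∀ i, j ≤ i → w i = v i := by
  induction j generalizing v with
  | zero => simp [tuples, funext_iff]
  | succ j ih =>
    simp only [tuples, List.mem_flatMap, List.mem_reverse, List.mem_range, ih]
    constructor
    · rintro ⟨a, ha, h1, h2⟩
      have hj := h2 j le_rfl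
      rw [Function.update_self] at hj
      refine ⟨fun i hi => ?_, fun i hi => ?_⟩
      · rcases Nat.lt_succ_iff_lt_or_eq.1 hi with hi | rfl
        · exact h1 i hi
        · omega
      · rw [h2 i (by omega), Function.update_of_ne (by omega)]
    · rintro ⟨h1, h2⟩
      refine ⟨w j, Nat.lt_succ_of_le (h1 j (by omega)), fun i hi => h1 i (by omega), fun i hi => ?_⟩
      rcases eq_or_ne i j with rfl | hij
      · simp
      · rw [Function.update_of_ne hij, h2 i (by omega)]

theorem join_map_some (o : Option A) : (o.map some).join = o := by cases o <;> rfl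

/-- The tops of `pre 0` and `post 0` are the letters on either side of the position `v 0`; they
select the program to run. -/
theorem go_body (W : List A) (v : ℕ → ℕ) (hv : ∀ j, v j ≤ W.length) (o : List Γ') :
    Go p (M * (2 * W.length + 3) + 2) .body (zip W v o) (nextLab _ 0) (zip W v (outAt p W v ++ o)) := by
  have h1 : Go p 1 .body (zip W v o) (.exec (p (W.take (v 0)).getLast? W[v 0]?)) (zip W v o) :=
    Go.single fun s => by
      simp [prog, zip, List.head?_drop, List.getLast?_map, join_map_some, -List.map_take]
  have h2 := go_exec (p := p) W v hv o _ (p (W.take (v 0)).getLast? W[v 0]?).2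
  refine (h1.trans h2).mono ?_
  have := Nat.mul_le_mul_right (2 * W.length + 3) (p (W.take (v 0)).getLast? W[v 0]?).2
  omega

/-- The time needed to treat the components `< j` of the tuple. -/
noncomputable def loopTime (M : ℕ) : ℕ → Polynomial ℕ
  | 0 => Polynomial.C M * (2 * Polynomial.X + 3) + 2
  | j + 1 => (Polynomial.X + 1) * (loopTime M j + Polynomial.X + 3)

theorem update_comp {B : Type*} (f : ℕ → B) (v : ℕ → ℕ) (j : Fin (K + 1)) (a : ℕ) :
    (fun i : Fin (K + 1) => f (Function.update v j a i)) =
      Function.update (fun i : Fin (K + 1) => f (v i)) j (f a) := by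
  funext i
  rcases eq_or_ne i j with rfl | h
  · simp
  · rw [Function.update_of_ne h, Function.update_of_ne (by simpa [Fin.ext_iff] using h)]

/-- The tuple is advanced like an odometer, with component `0` moving fastest. A component that has
reached the end of the word is reset to `0` and the next one moves. Since output is pushed, later
tuples appear first, in agreement with the reversed range in `tuples`. -/
theorem go_loop (W : List A) (j : ℕ) (hj : j ≤ K + 1) (v : ℕ → ℕ) (hv : ∀ i, v i ≤ W.length)
    (h0 : ∀ i < j, v i = 0) (o : List Γ') :
    Go p ((loopTime M j).eval W.length) .body (zip W v o) (nextLab _ j)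
      (zip W v ((tuples W.length j v).flatMap (outAt p W) ++ o)) := by
  induction j generalizing v o with
  | zero => simpa [loopTime, tuples] using go_body W v hv o
  | succ j ih =>
    have hj' : j < K + 1 := hj
    have hlab : nextLab (K := K) (Code K M) j = .next ⟨j, hj'⟩ := by simp [nextLab, hj']
    set T := (loopTime M j).eval W.length with hT
    -- Here `a` is the current value of component `j` and `r` the number of values still to come;
    -- the final `W.length + 1` steps pay for the reset.
    have key : ∀ r a, a + r = W.length → ∀ (v : ℕ → ℕ), (∀ i, v i ≤ W.length) →
        (∀ i < j, v i = 0) → v j = a → ∀ o,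
        Go p ((r + 1) * (T + 1) + W.length + 1) .body (zip W v o) (nextLab _ (j + 1))
          (zip W (Function.update v j 0) (((List.range' a (r + 1)).reverse.flatMap fun b =>
            (tuples W.length j (Function.update v j b)).flatMap (outAt p W)) ++ o)) := by
      intro r
      induction r with
      | zero =>
        intro a ha v hv h0 hva o
        have h1 := ih (by omega) v hv h0 o
        rw [hlab] at h1
        have h2 : ∀ o, Go p 1 (.next ⟨j, hj'⟩) (zip W v o) (.reset ⟨j, hj'⟩) (zip W v o) := fun o =>
          Go.single fun s => by
            have : W.drop (v j) = [] := by simp; omega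
            have e := Function.update_eq_self (⟨j, hj'⟩ : Fin (K + 1))
              fun j : Fin (K + 1) => (W.drop (v j)).map some
            simp only [this, List.map_nil] at e
            simp [prog, zip, this, e, -List.map_drop]
        have h3 : ∀ o, Go p (W.length + 1) (.reset ⟨j, hj'⟩) (zip W v o) (nextLab _ (j + 1))
            (zip W (Function.update v j 0) o) := fun o => by
          have := go_reset (p := p) ⟨j, hj'⟩ (W.take (v j)).reverse o
            (fun j : Fin (K + 1) => ((W.take (v j)).map some).reverse) (fun j => (W.drop (v j)).map some)
            (by simp)
          have e : W.take (v j) = W := List.take_of_length_le (by omega)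
          have e' : W.drop (v j) = [] := by simp; omega
          have u1 := update_comp (fun x => ((W.take x).map some).reverse) v ⟨j, hj'⟩ 0
          have u2 := update_comp (fun x => (W.drop x).map some) v ⟨j, hj'⟩ 0
          simp only [zip, u1, u2]
          simpa [e, e'] using this
        have h4 := (h1.trans (h2 _)).trans (h3 _)
        have hself : Function.update v j a = v := by rw [← hva, Function.update_eq_self]
        simpa [hself, Nat.add_assoc] using h4
      | succ r ihr =>
        intro a ha v hv h0 hva o
        have h1 := ih (by omega) v hv h0 o
        rw [hlab] at h1
        have h2 : ∀ o, Go p 1 (.next ⟨j, hj'⟩) (zip W v o) .body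
            (zip W (Function.update v j (a + 1)) o) := fun o =>
          Go.single fun s => by
            have u1 := update_comp (fun x => ((W.take x).map some).reverse) v ⟨j, hj'⟩ (a + 1)
            have u2 := update_comp (fun x => (W.drop x).map some) v ⟨j, hj'⟩ (a + 1)
            have ha' : a < W.length := by omega
            have e : (W.drop (v j)).map some = some W[a] :: (W.drop (a + 1)).map some := by
              rw [hva, List.drop_eq_getElem_cons ha', List.map_cons]
            have e' : ((W.take (a + 1)).map some).reverse =
                some W[a] :: ((W.take (v j)).map some).reverse := by
              rw [hva, List.take_add_one, List.map_append, List.reverse_append]; simp [ha']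
            simp only [zip, u1, u2, e']
            simp [prog, e, -List.map_take, -List.map_drop]
        have h3 := ihr (a + 1) (by omega) (Function.update v j (a + 1))
          (fun i => by
            rcases eq_or_ne i j with rfl | h
            · simp; omega
            · simpa [h] using hv i)
          (fun i hi => by rw [Function.update_of_ne (by omega)]; exact h0 i hi) (by simp)
          ((tuples W.length j v).flatMap (outAt p W) ++ o)
        have h4 := ((h1.trans (h2 _)).trans h3).mono
          (show _ ≤ (r + 1 + 1) * (T + 1) + W.length + 1 by
            rw [Nat.add_mul (r + 1)]; omega)
        have hself : Function.update v j a = v := by rw [← hva, Function.update_eq_self]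
        rw [show List.range' a (r + 1 + 1) = a :: List.range' (a + 1) (r + 1) from rfl]
        simpa [hself, Function.update_idem] using h4
    have h1 := key W.length 0 (by simp) v hv (fun i hi => h0 i (by omega)) (h0 j (by omega)) o
    have hself : Function.update v j 0 = v := by
      conv_rhs => rw [← Function.update_eq_self j v, h0 j (by omega)]
    rw [hself, ← List.range_eq_range'] at h1
    have h2 := h1.mono (show _ ≤ (loopTime M (j + 1)).eval W.length by
      simp only [loopTime, Polynomial.eval_mul, Polynomial.eval_add, Polynomial.eval_X,
        Polynomial.eval_one, Polynomial.eval_ofNat, ← hT]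
      nlinarith)
    rw [tuples, List.flatMap_assoc]
    exact h2

variable (p) in
/-- The machine, with its input and output. -/
noncomputable def machine [Fintype A] : FinTM2 where
  K := Stk K
  k₀ := .inp
  k₁ := .out
  Γ := Sym A
  Λ := Lab K (Code K M)
  main := .rev
  σ := Reg A
  initialState := (none, none)
  Γk₀Fin := inferInstanceAs (Fintype A)
  m := prog p

/-- A function whose values are printed tuple by tuple is computable in polynomial time. -/
theorem computable [Fintype A] {B : Type} (enc : B → List Γ') (f : List A → B)
    (hf : ∀ W, enc (f W) = (tuples W.length (K + 1) fun _ => 0).flatMap (outAt p W)) :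
    Nonempty (TM2ComputableInPolyTime (fun W : List A => W) enc f) := by
  refine ⟨⟨⟨machine p, Equiv.refl _, Equiv.refl _⟩, loopTime M (K + 1) + 3 * Polynomial.X + 3, fun W => ?_⟩⟩
  suffices h : ∃ k ≤ (loopTime M (K + 1) + 3 * Polynomial.X + 3).eval W.length,
      (flip bind (TM2.step (prog p)))^[k] (some ⟨some .rev, (none, none),
        stk W [] [] (fun _ => []) fun _ => []⟩) =
      some ⟨none, (none, none), stk [] (enc (f W)) [] (fun _ => []) fun _ => []⟩ by
    -- The run to be exhibited is data, so the number of steps is extracted by choice.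
    have h' := Classical.indefiniteDescription _ h
    refine ⟨⟨h'.1, ?_⟩, h'.2.1⟩
    have e1 : initList (machine p) (List.map (Equiv.refl A).invFun W) =
        ⟨some .rev, (none, none), stk W [] [] (fun _ => []) fun _ => []⟩ := by
      simp only [initList]
      congr 1
      funext k
      cases k <;> (simp [machine, stk]; try rfl)
    have e2 : haltList (machine p) (List.map (Equiv.refl Γ').invFun (enc (f W))) =
        ⟨none, (none, none), stk [] (enc (f W)) [] (fun _ => []) fun _ => []⟩ := by
      simp only [haltList]
      congr 1
      funext k
      cases k <;> (simp [machine, stk]; try rfl)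
    exact (congrArg _ (congrArg some e1)).trans (h'.2.2.trans (congrArg some e2.symm))
  have h1 := go_rev (p := p) W []
  have h2 := go_fill (p := p) W.reverse []
  have h3 := go_loop (p := p) W (K + 1) le_rfl (fun _ => 0) (by simp) (by simp) []
  have e3 : nextLab (K := K) (Code K M) (K + 1) = .clean := by simp [nextLab]
  rw [e3, ← hf] at h3
  simp only [List.append_nil, ← List.map_reverse, List.length_reverse, List.reverse_reverse] at h1 h2
  simp only [zip, List.take_zero, List.drop_zero, List.map_nil, List.reverse_nil, List.append_nil] at h3
  obtain ⟨s, k, hk, e⟩ := (h1.trans h2).trans h3 (none, none)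
  obtain ⟨k', hk', e'⟩ := iterate_clean (p := p) W.length W rfl (enc (f W)) s
  refine ⟨k' + k, ?_, by rw [Function.iterate_add_apply, e, e']⟩
  simp only [Polynomial.eval_mul, Polynomial.eval_add, Polynomial.eval_X, Polynomial.eval_ofNat]
  omega

end
end Printer

/-! ### Codes of states -/

/-- A number in unary. -/
def unary (a : ℕ) : List Bool := List.replicate a true ++ [false]

theorem unary_append_inj {a b : ℕ} {r s : List Bool} (h : unary a ++ r = unary b ++ s) :
    a = b ∧ r = s := by
  induction a generalizing b with
  | zero => cases b <;> simp_all [unary, List.replicate_succ]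
  | succ a ih =>
    cases b with
    | zero => simp [unary, List.replicate_succ] at h
    | succ b =>
      obtain ⟨h1, h2⟩ := ih (b := b) (by simpa [unary, List.replicate_succ] using h)
      exact ⟨by rw [h1], h2⟩

/-- The bits of a variable or function symbol. -/
def symbolBits : ℕ ⊕ (Σ k, sig.Functions k) → List Bool
  | .inl x => false :: unary x
  | .inr s => true :: (unary s.1 ++ unary s.2)

theorem symbolsBits_injective :
    Function.Injective fun l : List (ℕ ⊕ (Σ k, sig.Functions k)) => l.flatMap symbolBits := by
  intro l
  induction l with
  | nil =>
    intro l' h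
    rcases l' with _ | ⟨x | x, l'⟩ <;> simp_all [symbolBits]
  | cons x l ih =>
    intro l' h
    rcases l' with _ | ⟨y, l'⟩
    · rcases x with x | x <;> simp [symbolBits] at h
    · simp only [List.flatMap_cons] at h
      rcases x with x | ⟨k, x⟩ <;> rcases y with y | ⟨k', y⟩ <;>
        simp only [symbolBits, List.cons_append, List.cons.injEq, true_and, reduceCtorEq,
          false_and, List.append_assoc] at h
      · obtain ⟨rfl, h2⟩ := unary_append_inj h
        rw [ih h2]
      · obtain ⟨rfl, h2⟩ := unary_append_inj h
        obtain ⟨h3, h4⟩ := unary_append_inj h2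
        rw [ih h4]
        exact congrArg (fun z => Sum.inr ⟨k, z⟩ :: l') h3

/-- The bits of a term. -/
def termBits (t : Tm) : List Bool := t.listEncode.flatMap symbolBits

theorem termBits_injective : Function.Injective termBits :=
  symbolsBits_injective.comp Term.listEncode_injective

/-- The positive number with given binary digits below its leading `1`. -/
def posOfBits : List Bool → PosNum
  | [] => .one
  | false :: l => .bit0 (posOfBits l)
  | true :: l => .bit1 (posOfBits l)

theorem encodePosNum_posOfBits (l : List Bool) : encodePosNum (posOfBits l) = l ++ [true] := by
  induction l with
  | nil => rfl
  | cons b l ih => cases b <;> simp [posOfBits, encodePosNum, ih]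

/-- The number with given binary digits below its leading `1`. -/
def natOfBits (l : List Bool) : ℕ := posOfBits l

/-- Binary digits are written from the least significant one, so the chosen bits appear verbatim,
followed by the leading `1`. Printing such a number requires no arithmetic. -/
theorem encodeNat_natOfBits (l : List Bool) : encodeNat (natOfBits l) = l ++ [true] := by
  have h : ((posOfBits l : ℕ) : Num) = Num.pos (posOfBits l) := by
    simp
  rw [encodeNat, natOfBits, h]
  exact encodePosNum_posOfBits l

theorem natOfBits_injective : Function.Injective natOfBits := fun l l' h => by
  have := congrArg encodeNat h
  simpa [encodeNat_natOfBits] using this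

/-- The number of the unary function symbol that stands for a state. -/
def code (b : Bool) (c d : ℕ) (t : Tm) : ℕ := natOfBits (b :: (unary c ++ (unary d ++ termBits t)))

theorem code_inj {b b' : Bool} {c c' d d' : ℕ} {t t' : Tm} (h : code b c d t = code b' c' d' t') :
    b = b' ∧ c = c' ∧ d = d' ∧ t = t' := by
  obtain ⟨h1, h2⟩ := List.cons.inj (natOfBits_injective h)
  obtain ⟨h3, h4⟩ := unary_append_inj h2
  obtain ⟨h5, h6⟩ := unary_append_inj h4
  exact ⟨h1, h3, h5, termBits_injective h6⟩

/-! ### Templates of stack flows -/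

theorem varFinset_app (g : ℕ) (t : Tm) : (app g t).varFinset = t.varFinset := by
  ext; simp [app]

theorem varFinset_seqApp (τ : List ℕ) (t : Tm) : (seqApp τ t).varFinset = t.varFinset := by
  induction τ with
  | nil => rfl
  | cons g τ ih => rw [← ih]; exact varFinset_app g _

/-- The flow `τ(x) ↼ σ(x)`. -/
def unaryFlow (τ σ : List ℕ) : RawFlow where
  head := seqApp τ (tvar 0)
  body := seqApp σ (tvar 0)
  vars_subset := by rw [varFinset_seqApp, varFinset_seqApp]

/-- A transition between states `(c, d, T)` whose terms may contain variables for positions. -/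
structure Template where
  phase : Bool
  c : ℕ
  d : ℕ
  τ : List ℕ
  T : Tm
  c' : ℕ
  d' : ℕ
  σ : List ℕ
  U : Tm

/-- The flow obtained from a template for given positions. -/
def Template.flow (r : Template) (v : ℕ → ℕ) : RawFlow :=
  unaryFlow (code r.phase r.c r.d (r.T.relabel v) :: r.τ)
    (code (!r.phase) r.c' r.d' (r.U.relabel v) :: r.σ)

/-- The tuple of positions `v`, where the variable `K + 1` stands for the successor of `v 0`. -/
def withSucc (K n : ℕ) (v : ℕ → ℕ) (j : ℕ) : ℕ := if j = K + 1 then (v 0 + 1) % (n + 1) else v j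

/-- The flows obtained from templates, which may depend on the letters before and after the
position `v 0`, for all the tuples `v` of positions. -/
def reduction {A : Type} (K : ℕ) (tpl : Option A → Option A → List Template) (W : List A) : List RawFlow :=
  (Printer.tuples W.length (K + 1) fun _ => 0).flatMap fun v =>
    (tpl (W.take (v 0)).getLast? W[v 0]?).map fun r => r.flow (withSucc K W.length v)

/-! ### Printing programs for templates. -/

section
variable {K : ℕ}
open Printer

/-- The program that prints a fixed string. -/
def litProg (l : List Γ') : List (Instr K) := l.map .inl

/-- The program that prints a symbol of a template. -/
def symbolProg (last : Bool) : ℕ ⊕ (Σ k, sig.Functions k) → List (Instr K)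
  | .inl x => .inl (.bit false) ::
      ((if x = K + 1 then if last then [] else [.inl (.bit true), .inr 0]
        else if h : x < K + 1 then [.inr ⟨x, h⟩] else []) ++ [.inl (.bit false)])
  | .inr s => litProg ((symbolBits (.inr s)).map .bit)

/-- The program that prints the application of a sequence of unary symbols headed by a state. -/
def sideProg (last : Bool) (b : Bool) (c d : ℕ) (T : Tm) (τ : List ℕ) : List (Instr K) :=
  litProg (.ket :: encodeNum 1) ++ litProg ((b :: (unary c ++ unary d)).map .bit) ++
    T.listEncode.flatMap (symbolProg last) ++ litProg [.bit true, .comma] ++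
    litProg ((seqApp τ (tvar 0)).listEncode.flatMap encodeSymbol)

/-- The program that prints the flow of a template. -/
def templateProg (last : Bool) (r : Template) : List (Instr K) :=
  sideProg last r.phase r.c r.d r.T r.τ ++ sideProg last (!r.phase) r.c' r.d' r.U r.σ

theorem out_litProg (v : ℕ → ℕ) (l : List Γ') :
    (litProg l : List (Instr K)).flatMap (Instr.out v) = l := by
  induction l with
  | nil => rfl
  | cons γ l ih =>
    simp only [litProg, List.map_cons, List.flatMap_cons] at ih ⊢
    rw [ih]; rfl

theorem listEncode_relabel (t : Tm) (α : ℕ → ℕ) :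
    (t.relabel α).listEncode = t.listEncode.map (Sum.map α id) := by
  induction t with
  | var x => rfl
  | func f ts ih => simp [Term.listEncode, ih, List.map_flatMap]

/-- The flag `last` replaces the computation modulo `n + 1`: the successor of `v 0` is printed as
`0` at the last position and as one more bit than `v 0` elsewhere. Variables beyond `K + 1` stand
for `0` and print an empty unary block. -/
theorem out_symbolProg {n : ℕ} {v : ℕ → ℕ} {last : Bool} (hl : last = true ↔ v 0 = n) (h0 : v 0 ≤ n)
    (hv : ∀ i, K + 1 ≤ i → v i = 0) (s : ℕ ⊕ (Σ k, sig.Functions k)) :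
    (symbolProg last s : List (Instr K)).flatMap (Instr.out v) =
      (symbolBits (Sum.map (withSucc K n v) id s)).map .bit := by
  rcases s with x | s
  · rcases lt_trichotomy x (K + 1) with h | rfl | h
    · simp [symbolProg, symbolBits, Instr.out, withSucc, h, h.ne, unary]
    · cases last
      · have : v 0 ≠ n := fun h => Bool.false_ne_true (hl.2 h)
        have : (v 0 + 1) % (n + 1) = v 0 + 1 := Nat.mod_eq_of_lt (by omega)
        simp [symbolProg, symbolBits, Instr.out, withSucc, unary, this, List.replicate_succ]
      · have : (v 0 + 1) % (n + 1) = 0 := by rw [hl.1 rfl]; simp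
        simp [symbolProg, symbolBits, Instr.out, withSucc, unary, this]
    · have h1 : ¬ x < K + 1 := by omega
      simp [symbolProg, symbolBits, Instr.out, withSucc, h1, h.ne', unary, hv x h.le]
  · exact out_litProg _ _

theorem out_sideProg {n : ℕ} {v : ℕ → ℕ} {last : Bool} (hl : last = true ↔ v 0 = n) (h0 : v 0 ≤ n)
    (hv : ∀ i, K + 1 ≤ i → v i = 0) (b : Bool) (c d : ℕ) (T : Tm) (τ : List ℕ) :
    (sideProg last b c d T τ : List (Instr K)).flatMap (Instr.out v) =
      (seqApp (code b c d (T.relabel (withSucc K n v)) :: τ) (tvar 0)).listEncode.flatMap encodeSymbol := by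
  have h1 : (T.listEncode.flatMap (symbolProg last) : List (Instr K)).flatMap (Instr.out v) =
      (termBits (T.relabel (withSucc K n v))).map .bit := by
    rw [List.flatMap_assoc, termBits, listEncode_relabel]
    simp only [out_symbolProg hl h0 hv, List.map_flatMap, List.flatMap_map]
  have h2 : ∀ (q : ℕ) (t : Tm), (app q t).listEncode = .inr ⟨1, q⟩ :: t.listEncode := fun q t => by
    simp [app, Term.listEncode, List.finRange_succ]
  rw [show seqApp (code b c d (T.relabel (withSucc K n v)) :: τ) (tvar 0) =
    app (code b c d (T.relabel (withSucc K n v))) (seqApp τ (tvar 0)) from rfl, h2, List.flatMap_cons]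
  simp only [sideProg, List.flatMap_append, out_litProg, h1]
  -- The final pair is the leading binary digit of the code and the comma that ends the number.
  have h3 : encodeNum (code b c d (T.relabel (withSucc K n v))) =
      (b :: (unary c ++ (unary d ++ termBits (T.relabel (withSucc K n v))))).map .bit ++
        [.bit true, .comma] := by
    simp [encodeNum, code, encodeNat_natOfBits]
  simp only [encodeSymbol, h3]
  simp

theorem out_templateProg {n : ℕ} {v : ℕ → ℕ} {last : Bool} (hl : last = true ↔ v 0 = n) (h0 : v 0 ≤ n)
    (hv : ∀ i, K + 1 ≤ i → v i = 0) (r : Template) :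
    (templateProg last r : List (Instr K)).flatMap (Instr.out v) =
      encodeFlows [r.flow (withSucc K n v)] := by
  simp [templateProg, out_sideProg hl h0 hv, encodeFlows, Template.flow, unaryFlow]

theorem encodeFlows_flatMap {X : Type*} (l : List X) (f : X → List RawFlow) :
    encodeFlows (l.flatMap f) = l.flatMap fun x => encodeFlows (f x) := by
  simp only [encodeFlows, List.flatMap_assoc]

theorem encodeFlows_map {X : Type*} (l : List X) (f : X → RawFlow) :
    encodeFlows (l.map f) = l.flatMap fun x => encodeFlows [f x] := by
  rw [← encodeFlows_flatMap, ← List.map_eq_flatMap]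

end

open Printer in
theorem fptime_reduction {Sig : Finset ℕ} (K : ℕ) (tpl : Option Sig → Option Sig → List Template) :
    FPtime (reduction K tpl) := by
  -- Reversed because the output is a stack. The absence of a letter after the position signals the
  -- last position.
  let q : Option Sig → Option Sig → List (Instr K) := fun a b =>
    ((tpl a b).flatMap (templateProg b.isNone)).reverse
  -- Only finitely many pairs of letters occur, so the programs have bounded length and the machine
  -- has finitely many labels.
  obtain ⟨M, hM⟩ := Finite.exists_le fun x : Option Sig × Option Sig => (q x.1 x.2).length
  let p : Option Sig → Option Sig → Code K M := fun a b => ⟨q a b, hM (a, b)⟩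
  have key : ∀ W, encodeFlows (reduction K tpl W) =
      (tuples W.length (K + 1) fun _ => 0).flatMap (outAt p W) := by
    intro W
    rw [reduction, encodeFlows_flatMap]
    refine List.flatMap_congr fun v hv => ?_
    obtain ⟨h1, h2⟩ := mem_tuples.1 hv
    have h0 := h1 0 (by omega)
    have hl : W[v 0]?.isNone = true ↔ v 0 = W.length := by simp; omega
    simp only [outAt, p, q, List.reverse_reverse, encodeFlows_map, List.flatMap_assoc]
    exact List.flatMap_congr fun r _ => (out_templateProg hl h0 (fun i hi => h2 i hi) r).symm
  clear_value p
  exact computable encodeFlows (reduction K tpl) key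

/-! ### The transitions of an observation -/

theorem dot_inj {t u t' u' : Tm} : dot t u = dot t' u' ↔ t = t' ∧ u = u' := by
  simp [dot, funext_iff, Fin.forall_fin_two]

theorem const_inj {c c' : ℕ} : const c = const c' ↔ c = c' := by
  simp [const]

theorem app_inj {g g' : ℕ} {t t' : Tm} : app g t = app g' t' ↔ g = g' ∧ t = t' := by
  simp [app, funext_iff]

theorem app_ne_dot {g : ℕ} {t u v : Tm} : app g t ≠ dot u v := by
  simp [app, dot]

@[simp] theorem subst_const (c : ℕ) (η : ℕ → Tm) : (const c).subst η = const c := by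
  simp only [const, Term.subst]
  congr 1
  exact funext fun i => i.elim0

@[simp] theorem subst_app (g : ℕ) (t : Tm) (η : ℕ → Tm) : (app g t).subst η = app g (t.subst η) := by
  simp [app, funext_iff]

@[simp] theorem subst_dot (t u : Tm) (η : ℕ → Tm) :
    (dot t u).subst η = dot (t.subst η) (u.subst η) := by
  simp [dot, funext_iff, Fin.forall_fin_two]

@[simp] theorem subst_tvar_apply (x : ℕ) (η : ℕ → Tm) : (tvar x).subst η = η x := rfl

@[simp] theorem subst_seqApp (τ : List ℕ) (t : Tm) (η : ℕ → Tm) :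
    (seqApp τ t).subst η = seqApp τ (t.subst η) := by
  induction τ with
  | nil => rfl
  | cons g τ ih => simp only [seqApp, List.foldr_cons, subst_app] at ih ⊢; rw [ih]

theorem flowRel_isDot {f g h : Flow} (H : IsDot f g h) (X Y : Tm) :
    flowRel h X Y ↔ ∃ X₁ X₂ Y₁ Y₂, X = dot X₁ X₂ ∧ Y = dot Y₁ Y₂ ∧ flowRel f X₁ Y₁ ∧ flowRel g X₂ Y₂ := by
  obtain ⟨a, b, rfl, rfl, hd, rfl⟩ := H
  simp only [flowRel_toFlow]
  constructor
  · rintro ⟨η, rfl, rfl⟩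
    exact ⟨_, _, _, _, subst_dot .., subst_dot .., ⟨η, rfl, rfl⟩, ⟨η, rfl, rfl⟩⟩
  · rintro ⟨_, _, _, _, rfl, rfl, ⟨η₁, rfl, rfl⟩, ⟨η₂, rfl, rfl⟩⟩
    obtain ⟨η, e1, e2, e3, e4⟩ := subst_glue hd η₁ η₂
    exact ⟨η, by simp [RawFlow.dot, e1, e3], by simp [RawFlow.dot, e2, e4]⟩

theorem exists_flowRel (f : Flow) : ∃ X Y, flowRel f X Y := by
  obtain ⟨a, rfl⟩ := Quotient.exists_rep f
  exact ⟨_, _, a, rfl, tvar, rfl, rfl⟩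

/-- A product of `c ↼ c'` and `e ↼ e'` is defined only for `c' = e`, and is then `c ↼ e'`; so
generation produces nothing but flows between constants. -/
theorem flowRel_of_mem_constSemiring {C : Set ℕ} {F : Set Flow} (hF : F ∈ constSemiring C) {f : Flow}
    (hf : f ∈ F) : ∃ c c', ∀ X Y, flowRel f X Y ↔ X = const c ∧ Y = const c' := by
  replace hF : Generated _ F := hF
  induction hF generalizing f with
  | single g hg =>
    obtain rfl : f = g := hf
    obtain ⟨c, -, c', -, rfl⟩ := hg
    refine ⟨c, c', fun X Y => ?_⟩
    simp [constFlow, flowRel_toFlow]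
  | zero => exact hf.elim
  | add F G hF hG ihF ihG => exact hf.elim (fun h => ihF h) (fun h => ihG h)
  | mul F G hF hG ihF ihG =>
    obtain ⟨g, hg, g', hg', hp⟩ := hf
    obtain ⟨c, c', h1⟩ := ihF hg
    obtain ⟨e, e', h2⟩ := ihG hg'
    have h3 := flowRel_of_isProduct hp
    simp only [h1, h2] at h3
    obtain ⟨X, Y, hXY⟩ := exists_flowRel f
    obtain ⟨r, ⟨-, rfl⟩, h4, -⟩ := (h3 X Y).1 hXY
    refine ⟨c, e', fun X Y => ?_⟩
    rw [h3]
    exact ⟨fun ⟨r, ⟨h5, _⟩, _, h6⟩ => ⟨h5, h6⟩, fun ⟨h5, h6⟩ => ⟨_, ⟨h5, rfl⟩, h4, h6⟩⟩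

theorem exists_isDot_of_mem {A B : Set (Set Flow)} {H : Set Flow} (hH : H ∈ semiringDot A B) {h : Flow}
    (hh : h ∈ H) : ∃ F ∈ A, ∃ G ∈ B, ∃ f ∈ F, ∃ g ∈ G, IsDot f g h := by
  obtain ⟨L, hL, rfl⟩ := hH
  obtain ⟨q, hq, f, hf, g, hg, hd⟩ := hh
  exact ⟨q.1, (hL q hq).1, q.2, (hL q hq).2, f, hf, g, hg, hd⟩

theorem consts_relabel (α : ℕ → ℕ) (t : Tm) : consts (t.relabel α) = consts t := by
  induction t with
  | var x => rfl
  | func f ts ih => simp only [Term.relabel, consts, ih]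

theorem consts_dot (t u : Tm) : consts (dot t u) = consts t ∪ consts u := by
  ext c
  simp [dot, consts, Fin.exists_fin_two]

/-- The flow does not use the constants of `P`. -/
def Avoids (P : Set ℕ) (f : Flow) : Prop :=
  ∀ a : RawFlow, a.toFlow = f → Disjoint (consts a.head ∪ consts a.body) P

/-- Renaming variables leaves the constants unchanged, so one representative suffices. -/
theorem avoids_of_exists {P : Set ℕ} {f : Flow}
    (h : ∃ a : RawFlow, a.toFlow = f ∧ Disjoint (consts a.head ∪ consts a.body) P) : Avoids P f := by
  obtain ⟨a, rfl, ha⟩ := h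
  intro b hb
  obtain ⟨α, h1, h2⟩ := toFlow_eq_iff.1 hb.symm
  rwa [h1, h2, consts_relabel, consts_relabel]

theorem Avoids.of_isDot {P : Set ℕ} {f g h : Flow} (hh : Avoids P h) (H : IsDot f g h) :
    Avoids P g := by
  obtain ⟨a, b, rfl, rfl, -, rfl⟩ := H
  refine avoids_of_exists ⟨b, rfl, (hh _ rfl).mono_left ?_⟩
  simp only [RawFlow.dot, consts_dot]
  exact Set.union_subset_union Set.subset_union_right Set.subset_union_right

theorem height_dot (t u : Tm) : height (dot t u) = max (height t) (height u) + 1 := by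
  simp [dot, height, Fin.univ_succ, max_add_add_right]

theorem height_app (g : ℕ) (t : Tm) : height (app g t) = height t + 1 := by
  simp [app, height]

theorem height_seqApp (τ : List ℕ) (t : Tm) : height (seqApp τ t) = τ.length + height t := by
  induction τ with
  | nil => simp [seqApp]
  | cons g τ ih =>
    rw [show seqApp (g :: τ) t = app g (seqApp τ t) from rfl, height_app, ih, List.length_cons]
    omega

theorem height_isDot {f g h : Flow} (H : IsDot f g h) :
    h.height = max f.height g.height + 1 := by
  obtain ⟨a, b, rfl, rfl, -, rfl⟩ := H
  change max (height (dot a.head b.head)) (height (dot a.body b.body)) =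
    max (max (height a.head) (height a.body)) (max (height b.head) (height b.body)) + 1
  simp only [height_dot]
  omega

theorem height_le_wheight {F : Set Flow} (hF : F.Finite) {f : Flow} (hf : f ∈ F) :
    f.height ≤ wheight F :=
  le_csSup (hF.image _).bddAbove ⟨f, hf, rfl⟩

/-- A transition of an observation with stack: `c • d • τ(x) • t ↼ c' • d' • σ(x) • u`. -/
structure Rule where
  c : ℕ
  d : ℕ
  τ : List ℕ
  t : Tm
  c' : ℕ
  d' : ℕ
  σ : List ℕ
  u : Tm

/-- The term `c • d • s • y`. -/
def conf (c d : ℕ) (s y : Tm) : Tm := dot (const c) (dot (const d) (dot s y))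

theorem conf_inj {c d c' d' : ℕ} {s y s' y' : Tm} :
    conf c d s y = conf c' d' s' y' ↔ c = c' ∧ d = d' ∧ s = s' ∧ y = y' := by
  simp [conf, dot_inj, const_inj]

/-- Every occurrence of a variable `x` in `t` has the height `k x`. -/
def HasHeights (k : ℕ → ℕ) (t : Tm) : Prop := ∀ x, ∀ n ∈ occHeights x t, n = k x

/-- The properties of the transitions of an observation with stack of height `h` that does not use
the constants of `P`. -/
structure Rule.Good (P : Set ℕ) (h : ℕ) (r : Rule) : Prop where
  vars : r.t.varFinset ⊆ r.u.varFinset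
  balanced : ∃ k, HasHeights k r.t ∧ HasHeights k r.u
  avoids_t : Disjoint (consts r.t) P
  avoids_u : Disjoint (consts r.u) P
  length_τ : r.τ.length + 1 ≤ h
  length_σ : r.σ.length + 1 ≤ h

/-- The pairs of terms related by a transition. -/
def Rule.rel (r : Rule) (X Y : Tm) : Prop :=
  ∃ (s : Tm) (η : ℕ → Tm), X = conf r.c r.d (seqApp r.τ s) (r.t.subst η) ∧
    Y = conf r.c' r.d' (seqApp r.σ s) (r.u.subst η)

/-- Unfolding three uses of `•` separates the two constants, the stack flow and the balanced flow.
Their variables are disjoint, so the stack and the balanced part are instantiated independently. -/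
theorem exists_rule {Sig : Finset ℕ} {P : Set ℕ} {O : Set Flow} (hO : O ∈ stackObservations Sig P)
    {f : Flow} (hf : f ∈ O) :
    ∃ r : Rule, r.Good P (wheight O) ∧ ∀ X Y, flowRel f X Y ↔ r.rel X Y := by
  have hav : Avoids P f := avoids_of_exists (hO.2.2 f hf)
  have hh : f.height ≤ wheight O := height_le_wheight hO.2.1 hf
  obtain ⟨F₁, hF₁, G₁, hG₁, f₁, hf₁, g₁, hg₁, D₁⟩ := exists_isDot_of_mem hO.1 hf
  obtain ⟨F₂, hF₂, G₂, hG₂, f₂, hf₂, g₂, hg₂, D₂⟩ := exists_isDot_of_mem hG₁ hg₁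
  obtain ⟨F₃, hF₃, G₃, hG₃, f₃, hf₃, g₃, hg₃, D₃⟩ := exists_isDot_of_mem hG₂ hg₂
  obtain ⟨c, c', r₁⟩ := flowRel_of_mem_constSemiring hF₁ hf₁
  obtain ⟨d, d', r₂⟩ := flowRel_of_mem_constSemiring hF₂ hf₂
  obtain ⟨a, τ, σ, x, rfl, ha1, ha2⟩ := hF₃.2 f₃ hf₃
  obtain ⟨b, rfl, hb⟩ := hG₃.2 g₃ hg₃
  have hav' := ((hav.of_isDot D₁).of_isDot D₂).of_isDot D₃ b rfl
  rw [Set.disjoint_union_left] at hav'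
  -- Each of the three `•` above the stack flow adds one to the height, which leaves room for one
  -- state symbol above `τ` and `σ`.
  have hha : max (height a.head) (height a.body) + 3 ≤ wheight O := by
    have e1 := height_isDot D₁
    have e2 := height_isDot D₂
    have e3 := height_isDot D₃
    change _ = max (max (height a.head) (height a.body)) _ + 1 at e3
    omega
  rw [ha1, ha2, height_seqApp, height_seqApp] at hha
  refine ⟨⟨c, d, τ, b.head, c', d', σ, b.body⟩, ⟨b.vars_subset, ?_, hav'.1, hav'.2, ?_, ?_⟩, ?_⟩
  · classical
    -- Any occurrence gives the common height of a variable; for a variable without occurrence the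
    -- value `0` is arbitrary.
    refine ⟨fun x => if h : ∃ n, n ∈ occHeights x b.head ∪ occHeights x b.body then h.choose else 0,
      fun x n hn => ?_, fun x n hn => ?_⟩
    · have h : ∃ n, n ∈ occHeights x b.head ∪ occHeights x b.body := ⟨n, Or.inl hn⟩
      simp only [dif_pos h]
      exact hb x n (Or.inl hn) _ h.choose_spec
    · have h : ∃ n, n ∈ occHeights x b.head ∪ occHeights x b.body := ⟨n, Or.inr hn⟩
      simp only [dif_pos h]
      exact hb x n (Or.inr hn) _ h.choose_spec
  · simp only; omega
  · simp only; omega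
  · intro X Y
    rw [flowRel_isDot D₁]
    simp only [flowRel_isDot D₂, flowRel_isDot D₃, r₁, r₂, flowRel_toFlow, ha1, ha2, subst_seqApp,
      subst_tvar_apply, Rule.rel]
    constructor
    · rintro ⟨_, _, _, _, rfl, rfl, ⟨rfl, rfl⟩, _, _, _, _, rfl, rfl, ⟨rfl, rfl⟩, _, _, _, _, rfl, rfl,
        ⟨η, rfl, rfl⟩, ⟨η', rfl, rfl⟩⟩
      exact ⟨η x, η', rfl, rfl⟩
    · rintro ⟨s, η, rfl, rfl⟩
      exact ⟨_, _, _, _, rfl, rfl, ⟨rfl, rfl⟩, _, _, _, _, rfl, rfl, ⟨rfl, rfl⟩, _, _, _, _, rfl, rfl,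
        ⟨fun _ => s, rfl, rfl⟩, ⟨η, rfl, rfl⟩⟩

theorem exists_rules {Sig : Finset ℕ} {P : Set ℕ} {O : Set Flow} (hO : O ∈ stackObservations Sig P) :
    ∃ R : List Rule, (∀ r ∈ R, r.Good P (wheight O)) ∧
      ∀ X Y, wiringRel O X Y ↔ ∃ r ∈ R, r.rel X Y := by
  have : Nonempty Rule := ⟨⟨0, 0, [], tvar 0, 0, 0, [], tvar 0⟩⟩
  choose! ρ hρ using fun f (hf : f ∈ O) => exists_rule hO hf
  refine ⟨hO.2.1.toFinset.toList.map ρ, ?_, ?_⟩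
  · simp only [List.mem_map, Finset.mem_toList, Set.Finite.mem_toFinset]
    rintro r ⟨f, hf, rfl⟩
    exact (hρ f hf).1
  · intro X Y
    simp only [List.mem_map, Finset.mem_toList, Set.Finite.mem_toFinset, wiringRel]
    constructor
    · rintro ⟨f, hf, h⟩
      exact ⟨_, ⟨f, hf, rfl⟩, ((hρ f hf).2 X Y).1 h⟩
    · rintro ⟨r, ⟨f, hf, rfl⟩, h⟩
      exact ⟨f, hf, ((hρ f hf).2 X Y).2 h⟩

/-! ### The transitions of a word -/

/-- The term `x₁ • ⋯ • xₘ • head(x₀)`. -/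
def slotPattern (m : ℕ) : Tm :=
  ((List.range m).map (· + 1)).foldr (fun x u => dot (tvar x) u) (app hd (tvar 0))

/-- The term `t₁ • ⋯ • tₘ • head(q)`, where the `tᵢ` are given by `η`. -/
def slotTerm (m : ℕ) (η : ℕ → Tm) (q : Tm) : Tm := (slotPattern m).subst (Function.update η 0 q)

theorem subst_foldr_dot (l : List ℕ) (t : Tm) (η : ℕ → Tm) :
    (l.foldr (fun x u => dot (tvar x) u) t).subst η =
      l.foldr (fun x u => dot (η x) u) (t.subst η) := by
  induction l with
  | nil => rfl
  | cons x l ih => simp [ih]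

theorem subst_slots_succ (m : ℕ) (η : ℕ → Tm) (q : ℕ) :
    (slots (m + 1) (app hd (const q))).subst η = dot (η 0) (slotTerm m η (const q)) := by
  have h : ∀ (l : List ℕ) (t : Tm), (l.map (· + 1)).foldr (fun x u => dot (η x) u) t =
      (l.map (· + 1)).foldr (fun x u => dot (Function.update η 0 (const q) x) u) t := by
    intro l t
    induction l with
    | nil => rfl
    | cons x l ih => simp [ih]
  rw [slots, List.range_succ_eq_map, slotTerm, slotPattern, subst_foldr_dot, subst_foldr_dot]
  simp only [List.foldr_cons, subst_app, subst_const, subst_tvar_apply, Function.update_self]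
  rw [← h]

theorem varFinset_dot (t u : Tm) : (dot t u).varFinset = t.varFinset ∪ u.varFinset := by
  ext x; simp [dot, Fin.exists_fin_two]

theorem varFinset_const (c : ℕ) : (const c).varFinset = ∅ := by
  ext x; simp [const]

theorem varFinset_wordTerm (m c d p : ℕ) : (wordTerm m c d p).varFinset = Finset.range m := by
  have h : ∀ l : List ℕ, (l.foldr (fun x u => dot (tvar x) u) (app hd (const p))).varFinset =
      l.toFinset := by
    intro l
    induction l with
    | nil => simp [varFinset_app, varFinset_const]
    | cons x l ih => simp only [List.foldr_cons, varFinset_dot, ih]; simp [tvar]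
  rw [wordTerm, varFinset_dot, varFinset_dot, slots, h]
  ext; simp [varFinset_const]

/-- One of the two directions of a transition of a word; `q i` stands for the position `i`. -/
def wordStep {n : ℕ} (ℓ : Fin (n + 1) → ℕ) (q : Fin (n + 1) → Tm) (m : ℕ) (X Y : Tm) : Prop :=
  ∃ (i : Fin (n + 1)) (s : Tm) (η : ℕ → Tm),
    X = conf (ℓ i) rgt s (slotTerm m η (q i)) ∧ Y = conf (ℓ (i + 1)) lft s (slotTerm m η (q (i + 1)))

/-- The first slot of a word term faces the stack component of an observation. It is split off as
`s`, which frees the index `0` for the position in `slotTerm`. -/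
theorem wiringRel_wordRep (m : ℕ) {Sig : Finset ℕ} (W : List Sig) (p : Fin (W.length + 1) → ℕ) (X Y : Tm) :
    wiringRel (wordRep (m + 1) W p) X Y ↔
      wordStep (letter W) (fun i => const (p i)) m X Y ∨
        wordStep (letter W) (fun i => const (p i)) m Y X := by
  have e : ∀ c d q η, (wordTerm (m + 1) c d q).subst η = conf c d (η 0) (slotTerm m η (const q)) := by
    intro c d q η
    simp [wordTerm, subst_slots_succ, conf]
  have e' : ∀ c d q s η, (wordTerm (m + 1) c d q).subst (Function.update η 0 s) =
      conf c d s (slotTerm m η (const q)) := by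
    intro c d q s η
    rw [e]
    simp [slotTerm]
  constructor
  · rintro ⟨f, ⟨i, a, rfl, ⟨h1, h2⟩ | ⟨h1, h2⟩⟩, h⟩ <;> obtain ⟨η, rfl, rfl⟩ := flowRel_toFlow.1 h
    · exact Or.inl ⟨i, η 0, η, by rw [h1, e], by rw [h2, e]⟩
    · exact Or.inr ⟨i, η 0, η, by rw [h2, e], by rw [h1, e]⟩
  · rintro (⟨i, s, η, rfl, rfl⟩ | ⟨i, s, η, rfl, rfl⟩)
    · refine ⟨_, ⟨i, ⟨wordTerm (m + 1) _ _ _, wordTerm (m + 1) _ _ _,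
        by rw [varFinset_wordTerm, varFinset_wordTerm]⟩, rfl, Or.inl ⟨rfl, rfl⟩⟩,
        flowRel_toFlow.2 ⟨Function.update η 0 s, ?_, ?_⟩⟩ <;> rw [e']
    · refine ⟨_, ⟨i, ⟨wordTerm (m + 1) _ _ _, wordTerm (m + 1) _ _ _,
        by rw [varFinset_wordTerm, varFinset_wordTerm]⟩, rfl, Or.inr ⟨rfl, rfl⟩⟩,
        flowRel_toFlow.2 ⟨Function.update η 0 s, ?_, ?_⟩⟩ <;> rw [e']

/-- Without slots the word offers `head(p)` where a rule has a term `s • y`, so nothing unifies. -/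
theorem wmul_wordRep_zero {O : Set Flow} {R : List Rule}
    (hR : ∀ X Y, wiringRel O X Y ↔ ∃ r ∈ R, r.rel X Y) {Sig : Finset ℕ} (W : List Sig)
    (p : Fin (W.length + 1) → ℕ) : wmul O (wordRep 0 W p) = ∅ := by
  rw [eq_empty_iff_wiringRel]
  intro X Z h
  obtain ⟨Y, h1, f, ⟨i, a, rfl, h2⟩, h3⟩ := (wiringRel_wmul ..).1 h
  obtain ⟨η, rfl, -⟩ := flowRel_toFlow.1 h3
  obtain ⟨r, -, s, θ, -, h4⟩ := (hR ..).1 h1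
  rcases h2 with ⟨h2, -⟩ | ⟨h2, -⟩ <;>
    simp [h2, wordTerm, slots, conf, dot_inj, app_ne_dot] at h4

/-! ### Transition systems on nodes -/

/-- A node `(s, c, d, y)` stands for the term `c • d • s • y`. -/
abbrev Node : Type := Tm × ℕ × ℕ × Tm

/-- The steps between nodes given by the transitions `R`, where the last components are in `D`. -/
def ruleStep (R : List Rule) (D : Set Tm) (x y : Node) : Prop :=
  ∃ r ∈ R, ∃ (s : Tm) (η : ℕ → Tm), x = (seqApp r.τ s, r.c, r.d, r.t.subst η) ∧
    y = (seqApp r.σ s, r.c', r.d', r.u.subst η) ∧ r.t.subst η ∈ D ∧ r.u.subst η ∈ D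

/-- One direction of the steps between nodes given by a word, where the last components are in `D`. -/
def moveStep {n : ℕ} (ℓ : Fin (n + 1) → ℕ) (q : Fin (n + 1) → Tm) (m : ℕ) (D : Set Tm) (x y : Node) : Prop :=
  ∃ (i : Fin (n + 1)) (s : Tm) (η : ℕ → Tm), x = (s, ℓ i, rgt, slotTerm m η (q i)) ∧
    y = (s, ℓ (i + 1), lft, slotTerm m η (q (i + 1))) ∧
    slotTerm m η (q i) ∈ D ∧ slotTerm m η (q (i + 1)) ∈ D

/-- The steps between nodes given by a word, in both directions. -/
def moveSteps {n : ℕ} (ℓ : Fin (n + 1) → ℕ) (q : Fin (n + 1) → Tm) (m : ℕ) (D : Set Tm) (x y : Node) : Prop :=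
  moveStep ℓ q m D x y ∨ moveStep ℓ q m D y x

/-- Both relations live on terms of the shape `conf`, which determine their node; the product then
becomes an alternation of rule steps and moves. -/
theorem longPaths_wmul {O : Set Flow} {R : List Rule}
    (hR : ∀ X Y, wiringRel O X Y ↔ ∃ r ∈ R, r.rel X Y) (m : ℕ) {Sig : Finset ℕ} (W : List Sig)
    (p : Fin (W.length + 1) → ℕ) :
    LongPaths (wiringRel (wmul O (wordRep (m + 1) W p))) ↔
      LongPaths (alternate (ruleStep R Set.univ)
        (moveSteps (letter W) (fun i => const (p i)) m Set.univ)) := by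
  have hφ : Function.Injective fun x : Node => conf x.2.1 x.2.2.1 x.1 x.2.2.2 := by
    rintro ⟨s, c, d, y⟩ ⟨s', c', d', y'⟩ h
    obtain ⟨rfl, rfl, rfl, rfl⟩ := conf_inj.1 h
    rfl
  have h1 : ∀ X Y, wiringRel O X Y ↔ ∃ x y : Node, X = conf x.2.1 x.2.2.1 x.1 x.2.2.2 ∧
      Y = conf y.2.1 y.2.2.1 y.1 y.2.2.2 ∧ ruleStep R Set.univ x y := by
    intro X Y
    rw [hR]
    constructor
    · rintro ⟨r, hr, s, η, rfl, rfl⟩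
      exact ⟨_, _, rfl, rfl, r, hr, s, η, rfl, rfl, trivial, trivial⟩
    · rintro ⟨_, _, rfl, rfl, r, hr, s, η, rfl, rfl, -, -⟩
      exact ⟨r, hr, s, η, rfl, rfl⟩
  have h2 : ∀ X Y, wiringRel (wordRep (m + 1) W p) X Y ↔
      ∃ x y : Node, X = conf x.2.1 x.2.2.1 x.1 x.2.2.2 ∧ Y = conf y.2.1 y.2.2.1 y.1 y.2.2.2 ∧
        moveSteps (letter W) (fun i => const (p i)) m Set.univ x y := by
    intro X Y
    rw [wiringRel_wordRep]
    constructor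
    · rintro (⟨i, s, η, rfl, rfl⟩ | ⟨i, s, η, rfl, rfl⟩)
      · exact ⟨(_, _, _, _), (_, _, _, _), rfl, rfl, Or.inl ⟨i, s, η, rfl, rfl, trivial, trivial⟩⟩
      · exact ⟨(_, _, _, _), (_, _, _, _), rfl, rfl, Or.inr ⟨i, s, η, rfl, rfl, trivial, trivial⟩⟩
    · rintro ⟨_, _, rfl, rfl, ⟨i, s, η, rfl, rfl, -, -⟩ | ⟨i, s, η, rfl, rfl, -, -⟩⟩
      · exact Or.inl ⟨i, s, η, rfl, rfl⟩
      · exact Or.inr ⟨i, s, η, rfl, rfl⟩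
  rw [longPaths_alternate]
  refine longPaths_congr hφ fun X Z => ?_
  simp only [wiringRel_wmul, h1, h2]
  constructor
  · rintro ⟨_, ⟨x, y, rfl, rfl, hxy⟩, ⟨y', z, h, rfl, hyz⟩⟩
    obtain rfl := hφ h
    exact ⟨x, z, rfl, rfl, y, hxy, hyz⟩
  · rintro ⟨x, z, rfl, rfl, y, hxy, hyz⟩
    exact ⟨_, ⟨x, y, rfl, rfl, hxy⟩, ⟨y, z, rfl, rfl, hyz⟩⟩

theorem LongPaths.alternate_map {X Y : Type*} {A B : X → X → Prop} {A' B' : Y → Y → Prop} (φ : X → Y)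
    (hA : ∀ x y, A x y → A' (φ x) (φ y)) (hB : ∀ x y, B x y → B' (φ x) (φ y))
    (h : LongPaths (alternate A B)) : LongPaths (alternate A' B') := by
  refine h.map (fun x => (x.1, φ x.2)) ?_
  rintro ⟨b, x⟩ ⟨b', y⟩ ⟨h1, h2⟩
  refine ⟨h1, ?_⟩
  cases b
  · exact hA x y h2
  · exact hB x y h2

/-! ### Truncation of terms -/

/-- The function symbols of a term, with their arities. -/
def symbols : Tm → Finset (Σ _ : ℕ, ℕ)
  | .var _ => ∅
  | .func (l := l) f ts => insert ⟨l, f⟩ (Finset.univ.biUnion fun i => symbols (ts i))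

/-- The terms of height at most `k` with symbols in `S` and variables `< n`. -/
def bounded (k : ℕ) (S : Finset (Σ _ : ℕ, ℕ)) (n : ℕ) : Set Tm :=
  {t | height t ≤ k ∧ symbols t ⊆ S ∧ t.varFinset ⊆ Finset.range n}

theorem height_le_of_func {l : ℕ} {f : sig.Functions l} {ts : Fin l → Tm} {k : ℕ} :
    height (.func f ts) ≤ k ↔ ∀ i, height (ts i) + 1 ≤ k := by
  simp [height]

/-- The truncation of a term at depth `k`. Constants with a position are replaced by variables, and
what is cut off or headed by a symbol outside `S` by a constant. -/
def trunc (S : Finset (Σ _ : ℕ, ℕ)) (pos : ℕ → Option ℕ) : Tm → ℕ → Tm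
  | .var _, _ => const star
  | .func (l := l) f ts, k =>
    match (if l = 0 then pos f else none) with
    | some i => tvar i
    | none => if (⟨l, f⟩ : Σ _ : ℕ, ℕ) ∈ S ∧ (l = 0 ∨ k ≠ 0) then
        .func f fun i => trunc S pos (ts i) (k - 1) else const star

section
variable {S : Finset (Σ _ : ℕ, ℕ)} {pos : ℕ → Option ℕ}

theorem height_const (c : ℕ) : height (const c) = 0 := by simp [const, height]

theorem symbols_const (c : ℕ) : symbols (const c) = {⟨0, c⟩} := by simp [const, symbols]

theorem trunc_mem_bounded (hS : ⟨0, star⟩ ∈ S) {n : ℕ} (hpos : ∀ c i, pos c = some i → i < n)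
    (t : Tm) (k : ℕ) : trunc S pos t k ∈ bounded k S n := by
  have hc : ∀ k, const star ∈ bounded k S n := fun k =>
    ⟨by simp [height_const], by simpa [symbols_const] using hS, by simp [varFinset_const]⟩
  induction t generalizing k with
  | var x => exact hc k
  | @func l f ts ih =>
    rw [trunc]
    split
    · rename_i i h
      split_ifs at h with hl
      refine ⟨by simp [tvar, height], by simp [tvar, symbols], ?_⟩
      simpa [tvar] using hpos _ _ h
    · split_ifs with h
      · refine ⟨height_le_of_func.2 fun i => ?_, ?_, ?_⟩
        · have h1 := (ih i (k - 1)).1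
          have h2 : k ≠ 0 := h.2.resolve_left (by rintro rfl; exact i.elim0)
          omega
        · rw [symbols, Finset.insert_subset_iff]
          refine ⟨h.1, Finset.biUnion_subset.2 fun i _ => (ih i (k - 1)).2.1⟩
        · rw [Term.varFinset]
          exact Finset.biUnion_subset.2 fun i _ => (ih i (k - 1)).2.2
      · exact hc k

theorem trunc_const {c i : ℕ} (h : pos c = some i) (k : ℕ) : trunc S pos (const c) k = tvar i := by
  simp [const, trunc, h]

/-- Below a variable `x` of `t` the remaining depth is `k - h x` at every occurrence, so a single
truncated value of `η x` serves them all. This is where balance is indispensable. The symbols of `t`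
itself survive because they lie in `S`, within depth `k`, and are not position constants. -/
theorem trunc_subst {k : ℕ} {h : ℕ → ℕ} {η : ℕ → Tm} (t : Tm) (d : ℕ) (hS : symbols t ⊆ S)
    (hpos : ∀ c ∈ consts t, pos c = none) (hk : height t + d ≤ k)
    (hh : ∀ x, ∀ n ∈ occHeights x t, n + d = h x) :
    trunc S pos (t.subst η) (k - d) = t.subst fun x => trunc S pos (η x) (k - h x) := by
  induction t generalizing d with
  | var x =>
    have := hh x 0 ⟨rfl, rfl⟩
    simp only [Term.subst, ← this, Nat.zero_add]
  | @func l f ts ih =>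
    have h1 : (if l = 0 then pos f else none) = none := by
      split_ifs with hl
      · exact hpos f (Or.inl ⟨hl, rfl⟩)
      · rfl
    have hS' := Finset.insert_subset_iff.1 hS
    have hk' := height_le_of_func.1 (show height (.func f ts) ≤ k - d by omega)
    have h2 : l = 0 ∨ k - d ≠ 0 := by
      rcases Nat.eq_zero_or_pos l with hl | hl
      · exact Or.inl hl
      · have := hk' ⟨0, hl⟩
        exact Or.inr (by omega)
    simp only [Term.subst]
    rw [trunc, h1]
    simp only [if_pos (And.intro hS'.1 h2)]
    congr 1
    funext i
    rw [Nat.sub_sub]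
    refine ih i (d + 1) (Finset.biUnion_subset.1 hS'.2 i (Finset.mem_univ i))
      (fun c hc => hpos c (Or.inr ⟨i, hc⟩)) ?_ ?_
    · have := hk' i
      omega
    · intro x n hn
      rw [← hh x (n + 1) ⟨i, n, hn, rfl⟩]
      ring

end

theorem slotPattern_eq (m : ℕ) : slotPattern m =
    (List.range' (0 + 1) m).foldr (fun x u => dot (tvar x) u) (app hd (tvar 0)) := by
  rw [slotPattern, List.range'_eq_map_range]
  congr 2
  funext x
  omega

theorem occHeights_dot {x n : ℕ} {t u : Tm} :
    n ∈ occHeights x (dot t u) ↔ ∃ n', (n' ∈ occHeights x t ∨ n' ∈ occHeights x u) ∧ n = n' + 1 := by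
  simp only [dot, occHeights, Fin.exists_fin_two, Set.mem_ofPred_eq, Matrix.cons_val_zero,
    Matrix.cons_val_one]
  constructor
  · rintro (⟨n', h, rfl⟩ | ⟨n', h, rfl⟩)
    · exact ⟨n', Or.inl h, rfl⟩
    · exact ⟨n', Or.inr h, rfl⟩
  · rintro ⟨n', h | h, rfl⟩
    · exact Or.inl ⟨n', h, rfl⟩
    · exact Or.inr ⟨n', h, rfl⟩

/-- The height of a variable of `slotPattern m`. -/
def slotHeight (m x : ℕ) : ℕ := if x = 0 then m + 1 else x

theorem hasHeights_slotPattern (m : ℕ) : HasHeights (slotHeight m) (slotPattern m) := by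
  -- The offset `a` counts the slots already passed, which makes the induction on the remaining ones
  -- possible.
  have key : ∀ m a x, ∀ n ∈ occHeights x
      ((List.range' (a + 1) m).foldr (fun x u => dot (tvar x) u) (app hd (tvar 0))),
      n + a = if x = 0 then a + m + 1 else x := by
    intro m
    induction m with
    | zero =>
      rintro a x n ⟨i, n', hn, rfl⟩
      obtain rfl : i = 0 := Subsingleton.elim _ _
      obtain ⟨rfl, rfl⟩ : 0 = x ∧ n' = 0 := hn
      simp; omega
    | succ m ih =>
      intro a x n hn
      rw [List.range'_succ, List.foldr_cons, occHeights_dot] at hn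
      obtain ⟨n', h | h, rfl⟩ := hn
      · obtain ⟨rfl, rfl⟩ : a + 1 = x ∧ n' = 0 := h
        simp; omega
      · have := ih (a + 1) x n' h
        split_ifs at this ⊢ <;> omega
  intro x n hn
  rw [slotPattern_eq] at hn
  have := key m 0 x n hn
  simpa [slotHeight] using this

theorem symbols_dot (t u : Tm) : symbols (dot t u) = insert ⟨2, 0⟩ (symbols t ∪ symbols u) := by
  ext x
  simp [dot, symbols, Fin.exists_fin_two]

theorem symbols_slotPattern (m : ℕ) : symbols (slotPattern m) ⊆ {⟨1, 0⟩, ⟨2, 0⟩} := by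
  rw [slotPattern]
  induction (List.range m).map (· + 1) with
  | nil => simp [app, symbols, hd, tvar]
  | cons x l ih =>
    rw [List.foldr_cons, symbols_dot]
    simp only [tvar, symbols, Finset.empty_union] at ih ⊢
    exact Finset.insert_subset (by simp) ih

theorem height_slotPattern (m : ℕ) : height (slotPattern m) = m + 1 := by
  rw [slotPattern]
  suffices h : ∀ l : List ℕ,
      height (l.foldr (fun x u => dot (tvar x) u) (app hd (tvar 0))) = l.length + 1 by simp [h]
  intro l
  induction l with
  | nil => simp [height_app, tvar, height]
  | cons x l ih => rw [List.foldr_cons, height_dot, ih]; simp [tvar, height]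

theorem consts_slotPattern (m : ℕ) : consts (slotPattern m) = ∅ := by
  rw [slotPattern]
  induction (List.range m).map (· + 1) with
  | nil => simp [app, consts, tvar]
  | cons x l ih => rw [List.foldr_cons, consts_dot, ih]; simp [tvar, consts]

/-- Hypotheses on the depth `k` and on the set of symbols `S` used to truncate. -/
structure TruncBounds (R : List Rule) (m k : ℕ) (S : Finset (Σ _ : ℕ, ℕ)) : Prop where
  height_t : ∀ r ∈ R, height r.t ≤ k
  height_u : ∀ r ∈ R, height r.u ≤ k
  symbols_t : ∀ r ∈ R, symbols r.t ⊆ S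
  symbols_u : ∀ r ∈ R, symbols r.u ⊆ S
  slots : m + 1 ≤ k
  star_mem : ⟨0, star⟩ ∈ S
  hd_mem : ⟨1, 0⟩ ∈ S
  dot_mem : ⟨2, 0⟩ ∈ S

theorem exists_truncBounds (R : List Rule) (m : ℕ) : ∃ k S, TruncBounds R m k S := by
  classical
  let k := (R.map fun r => height r.t + height r.u).sum + (m + 1)
  let S := R.toFinset.biUnion (fun r => symbols r.t ∪ symbols r.u) ∪ {⟨0, star⟩, ⟨1, 0⟩, ⟨2, 0⟩}
  have hk : ∀ r ∈ R, height r.t + height r.u ≤ k := fun r hr =>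
    (List.single_le_sum (by simp) _ (List.mem_map_of_mem (f := fun r : Rule => height r.t + height r.u) hr)).trans (Nat.le_add_right _ _)
  have hS : ∀ r ∈ R, symbols r.t ∪ symbols r.u ⊆ S := fun r hr =>
    (Finset.subset_biUnion_of_mem (fun r => symbols r.t ∪ symbols r.u)
      (List.mem_toFinset.2 hr)).trans Finset.subset_union_left
  exact ⟨k, S, fun r hr => (Nat.le_add_right _ _).trans (hk r hr),
    fun r hr => (Nat.le_add_left _ _).trans (hk r hr),
    fun r hr => Finset.subset_union_left.trans (hS r hr),
    fun r hr => Finset.subset_union_right.trans (hS r hr), Nat.le_add_left _ _,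
    by simp [S], by simp [S], by simp [S]⟩

/-- Truncation maps steps to steps by `trunc_subst`, for rules because they are balanced and avoid
`P`, and for moves because `slotPattern` has the same properties. Conversely, steps are stable under
substitution, so putting the constants back for the variables suffices. The stack component is never
touched. -/
theorem longPaths_truncate {P : Set ℕ} {h : ℕ} {R : List Rule} (hR : ∀ r ∈ R, r.Good P h) {m k : ℕ}
    {S : Finset (Σ _ : ℕ, ℕ)} (hB : TruncBounds R m k S) {n : ℕ} (ℓ : Fin (n + 1) → ℕ)
    {p : Fin (n + 1) → ℕ} (hp : Function.Injective p) (hpP : ∀ i, p i ∈ P) :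
    LongPaths (alternate (ruleStep R Set.univ) (moveSteps ℓ (fun i => const (p i)) m Set.univ)) ↔
      LongPaths (alternate (ruleStep R (bounded k S (n + 1)))
        (moveSteps ℓ (fun i => tvar i) m (bounded k S (n + 1)))) := by
  classical
  constructor
  -- The inverse of `p`, well defined by injectivity.
  · let pos : ℕ → Option ℕ := fun c => if h : ∃ i, p i = c then some h.choose else none
    have hpos : ∀ i, pos (p i) = some i := by
      intro i
      have h : ∃ j, p j = p i := ⟨i, rfl⟩
      simp only [pos, dif_pos h, hp h.choose_spec]
      rfl
    have hnone : ∀ c ∉ P, pos c = none := by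
      intro c hc
      refine dif_neg ?_
      rintro ⟨i, rfl⟩
      exact hc (hpP i)
    have hlt : ∀ c i, pos c = some i → i < n + 1 := by
      intro c i hi
      simp only [pos] at hi
      split_ifs at hi with h
      obtain rfl := Option.some.inj hi
      exact h.choose.2
    have hmem : ∀ t, trunc S pos t k ∈ bounded k S (n + 1) := fun t =>
      trunc_mem_bounded hB.star_mem hlt t k
    have hslot : ∀ η i, trunc S pos (slotTerm m η (const (p i))) k =
        slotTerm m (fun x => trunc S pos (η x) (k - slotHeight m x)) (tvar i) := by
      intro η i
      have hsub : symbols (slotPattern m) ⊆ S := (symbols_slotPattern m).trans (by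
        simp [Finset.insert_subset_iff, hB.hd_mem, hB.dot_mem])
      have := trunc_subst (S := S) (pos := pos) (k := k) (η := Function.update η 0 (const (p i)))
        (slotPattern m) 0 hsub (by simp [consts_slotPattern])
        (by simpa [height_slotPattern] using hB.slots) (hasHeights_slotPattern m)
      rw [slotTerm, slotTerm]
      refine this.trans (congrArg _ (funext fun x => ?_))
      rcases eq_or_ne x 0 with rfl | hx
      · simp [trunc_const (hpos i)]
      · simp [hx]
    have hmove : ∀ x y : Node, moveStep ℓ (fun i => const (p i)) m Set.univ x y →
        moveStep ℓ (fun i => tvar i) m (bounded k S (n + 1))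
          (x.1, x.2.1, x.2.2.1, trunc S pos x.2.2.2 k) (y.1, y.2.1, y.2.2.1, trunc S pos y.2.2.2 k) := by
      rintro _ _ ⟨i, s, η, rfl, rfl, -, -⟩
      refine ⟨i, s, fun x => trunc S pos (η x) (k - slotHeight m x), ?_, ?_, ?_, ?_⟩ <;>
        simp only [← hslot, hmem]
    refine LongPaths.alternate_map
      (fun x : Node => (x.1, x.2.1, x.2.2.1, trunc S pos x.2.2.2 k)) ?_ ?_
    · rintro _ _ ⟨r, hr, s, η, rfl, rfl, -, -⟩
      obtain ⟨g, hg1, hg2⟩ := (hR r hr).balanced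
      have e1 : trunc S pos (r.t.subst η) k = r.t.subst fun x => trunc S pos (η x) (k - g x) :=
        trunc_subst r.t 0 (hB.symbols_t r hr)
          (fun c hc => hnone c (Set.disjoint_left.1 (hR r hr).avoids_t hc)) (hB.height_t r hr) hg1
      have e2 : trunc S pos (r.u.subst η) k = r.u.subst fun x => trunc S pos (η x) (k - g x) :=
        trunc_subst r.u 0 (hB.symbols_u r hr)
          (fun c hc => hnone c (Set.disjoint_left.1 (hR r hr).avoids_u hc)) (hB.height_u r hr) hg2
      exact ⟨r, hr, s, fun x => trunc S pos (η x) (k - g x), by simp only [e1], by simp only [e2],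
        e1 ▸ hmem _, e2 ▸ hmem _⟩
    · exact fun x y hxy => hxy.imp (hmove x y) (hmove y x)
  -- Variables that are not positions do not matter and are kept.
  · let ρ : ℕ → Tm := fun j => if h : j < n + 1 then const (p ⟨j, h⟩) else tvar j
    have hρ : ∀ i : Fin (n + 1), ρ i = const (p i) := fun i => dif_pos i.2
    have hslot : ∀ η (i : Fin (n + 1)), (slotTerm m η (tvar i)).subst ρ =
        slotTerm m (fun x => (η x).subst ρ) (const (p i)) := by
      intro η i
      rw [slotTerm, slotTerm, subst_subst]
      refine congrArg _ (funext fun x => ?_)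
      rcases eq_or_ne x 0 with rfl | hx
      · simp [hρ]
      · simp [hx]
    have hmove : ∀ x y : Node, moveStep ℓ (fun i => tvar i) m (bounded k S (n + 1)) x y →
        moveStep ℓ (fun i => const (p i)) m Set.univ
          (x.1, x.2.1, x.2.2.1, x.2.2.2.subst ρ) (y.1, y.2.1, y.2.2.1, y.2.2.2.subst ρ) := by
      rintro _ _ ⟨i, s, η, rfl, rfl, -, -⟩
      exact ⟨i, s, fun x => (η x).subst ρ, by simp only [hslot], by simp only [hslot], trivial, trivial⟩
    refine LongPaths.alternate_map (fun x : Node => (x.1, x.2.1, x.2.2.1, x.2.2.2.subst ρ)) ?_ ?_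
    · rintro _ _ ⟨r, hr, s, η, rfl, rfl, -, -⟩
      exact ⟨r, hr, s, fun x => (η x).subst ρ, by simp only [subst_subst],
        by simp only [subst_subst], trivial, trivial⟩
    · exact fun x y hxy => hxy.imp (hmove x y) (hmove y x)

/-! ### Bounded terms -/

theorem symbols_relabel (t : Tm) (α : ℕ → ℕ) : symbols (t.relabel α) = symbols t := by
  induction t with
  | var x => rfl
  | func f ts ih => simp only [Term.relabel, symbols, ih]

theorem relabel_mem_bounded {k : ℕ} {S : Finset (Σ _ : ℕ, ℕ)} {n n' : ℕ} {t : Tm} {α : ℕ → ℕ}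
    (ht : t ∈ bounded k S n) (hα : ∀ x ∈ t.varFinset, α x < n') : t.relabel α ∈ bounded k S n' := by
  refine ⟨(height_relabel α t).trans_le ht.1, (symbols_relabel t α).trans_subset ht.2.1, fun x hx => ?_⟩
  rw [varFinset_relabel, Finset.mem_image] at hx
  obtain ⟨y, hy, rfl⟩ := hx
  exact Finset.mem_range.2 (hα y hy)

theorem relabel_relabel_eq {t : Tm} {α β : ℕ → ℕ} (h : ∀ x ∈ t.varFinset, β (α x) = x) :
    (t.relabel α).relabel β = t := by
  rw [Term.relabel_relabel]
  conv_rhs => rw [← Term.relabel_id t]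
  exact relabel_congr h

theorem finite_func_terms (S : Finset (Σ _ : ℕ, ℕ)) {C : Set Tm} (hC : C.Finite) :
    {t : Tm | ∃ a ∈ S, ∃ ts : Fin a.1 → Tm, (∀ i, ts i ∈ C) ∧ t = Term.func (L := sig) a.2 ts}.Finite := by
  refine (S.finite_toSet.biUnion fun a _ => (Set.Finite.pi' fun _ : Fin a.1 => hC).image
    fun ts => Term.func (L := sig) (l := a.1) a.2 ts).subset ?_
  rintro _ ⟨a, ha, ts, hts, rfl⟩
  exact Set.mem_biUnion ha ⟨ts, hts, rfl⟩

theorem finite_bounded (k : ℕ) (S : Finset (Σ _ : ℕ, ℕ)) (n : ℕ) : (bounded k S n).Finite := by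
  have hv : (tvar '' (Finset.range n : Set ℕ)).Finite := (Finset.finite_toSet _).image _
  induction k with
  | zero =>
    refine (hv.union (finite_func_terms S Set.finite_empty)).subset ?_
    rintro (x | @⟨l, f, ts⟩) ⟨h1, h2, h3⟩
    · exact Or.inl ⟨x, by simpa using h3, rfl⟩
    · refine Or.inr ⟨⟨l, f⟩, (Finset.insert_subset_iff.1 h2).1, ts, fun i => ?_, rfl⟩
      have := height_le_of_func.1 h1 i
      omega
  | succ k ih =>
    refine (hv.union (finite_func_terms S ih)).subset ?_
    rintro (x | @⟨l, f, ts⟩) ⟨h1, h2, h3⟩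
    · exact Or.inl ⟨x, by simpa using h3, rfl⟩
    · have h2' := Finset.insert_subset_iff.1 h2
      refine Or.inr ⟨⟨l, f⟩, h2'.1, ts, fun i => ⟨?_, ?_, ?_⟩, rfl⟩
      · have := height_le_of_func.1 h1 i
        omega
      · exact Finset.biUnion_subset.1 h2'.2 i (Finset.mem_univ i)
      · rw [Term.varFinset] at h3
        exact Finset.biUnion_subset.1 h3 i (Finset.mem_univ i)

/-- Height and arities are bounded, hence so is the number of leaves. The bound does not involve the
number of available variables, that is, the length of the word. -/
theorem exists_card_vars_le (k : ℕ) (S : Finset (Σ _ : ℕ, ℕ)) :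
    ∃ K, ∀ t : Tm, height t ≤ k → symbols t ⊆ S → t.varFinset.card ≤ K := by
  induction k with
  | zero =>
    refine ⟨1, ?_⟩
    rintro (x | @⟨l, f, ts⟩) h1 h2
    · simp
    · have : Term.varFinset (Term.func f ts) ⊆ ∅ := by
        rw [Term.varFinset]
        exact Finset.biUnion_subset.2 fun i _ => absurd (height_le_of_func.1 h1 i) (by omega)
      rw [Finset.subset_empty.1 this]
      simp
  | succ k ih =>
    obtain ⟨K, hK⟩ := ih
    refine ⟨1 + S.sup (fun a => a.1) * K, ?_⟩
    rintro (x | @⟨l, f, ts⟩) h1 h2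
    · simp
    · have h2' := Finset.insert_subset_iff.1 h2
      have h3 : l ≤ S.sup (fun a => a.1) :=
        Finset.le_sup (f := fun a : (Σ _ : ℕ, ℕ) => a.1) h2'.1
      have h4 : (Term.varFinset (Term.func f ts)).card ≤ (Finset.univ : Finset (Fin l)).card * K := by
        rw [Term.varFinset]
        refine Finset.card_biUnion_le_card_mul _ _ _ fun i _ => hK _ ?_ ?_
        · have := height_le_of_func.1 h1 i
          omega
        · exact Finset.biUnion_subset.1 h2'.2 i (Finset.mem_univ i)
      rw [Finset.card_univ, Fintype.card_fin] at h4
      have := Nat.mul_le_mul_right K h3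
      omega

/-! ### Tuples of positions -/

theorem withSucc_of_ne {K n : ℕ} {v : ℕ → ℕ} {j : ℕ} (h : j ≠ K + 1) : withSucc K n v j = v j := if_neg h

theorem withSucc_lt {K n : ℕ} {v : ℕ → ℕ} (hv : ∀ j, v j ≤ n) (j : ℕ) : withSucc K n v j < n + 1 := by
  rw [withSucc]
  split_ifs
  · exact Nat.mod_lt _ (Nat.succ_pos n)
  · exact Nat.lt_succ_of_le (hv j)

theorem le_of_mem_tuples {K n : ℕ} {v : ℕ → ℕ} (hv : v ∈ Printer.tuples n (K + 1) fun _ => 0) (j : ℕ) :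
    v j ≤ n := by
  obtain ⟨h1, h2⟩ := Printer.mem_tuples.1 hv
  rcases Nat.lt_or_ge j (K + 1) with h | h
  · exact h1 j h
  · rw [h2 j h]
    exact Nat.zero_le n

/-- Component `0` is reserved for `i`, and the at most `K` elements of `V` occupy the following
ones; `e` sends an element to its component. The remaining components are `0`, as `tuples` requires.
-/
theorem exists_tuple {K n i : ℕ} (hi : i ≤ n) {V : Finset ℕ} (hV : V ⊆ Finset.range (n + 1))
    (hK : V.card ≤ K) :
    ∃ v ∈ Printer.tuples n (K + 1) fun _ => 0, v 0 = i ∧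
      ∃ e : ℕ → ℕ, ∀ a ∈ V, e a < K + 1 ∧ withSucc K n v (e a) = a := by
  have hlen : V.toList.length = V.card := Finset.length_toList V
  refine ⟨fun j => if j = 0 then i else V.toList.getD (j - 1) 0, Printer.mem_tuples.2 ⟨?_, ?_⟩, rfl,
    fun a => V.toList.idxOf a + 1, ?_⟩
  · intro j _
    split_ifs
    · exact hi
    · rcases Nat.lt_or_ge (j - 1) V.toList.length with h | h
      · rw [List.getD_eq_getElem _ _ h]
        have := hV (Finset.mem_toList.1 (List.getElem_mem h))
        simpa using Nat.lt_succ_iff.1 (Finset.mem_range.1 this)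
      · rw [List.getD_eq_default _ _ h]
        exact Nat.zero_le n
  · intro j hj
    rw [if_neg (by omega), List.getD_eq_default _ _ (by omega)]
  · intro a ha
    have h := List.idxOf_lt_length_iff.2 (Finset.mem_toList.2 ha)
    beta_reduce
    refine ⟨by omega, ?_⟩
    rw [withSucc_of_ne (by omega)]
    simp [List.getElem?_eq_getElem h]

/-! ### Templates of rules -/

/-- `T` and `U` are instances of the two sides of a rule. -/
def RuleInstance (r : Rule) (D : Set Tm) (T U : Tm) : Prop :=
  ∃ η : ℕ → Tm, T = r.t.subst η ∧ U = r.u.subst η ∧ T ∈ D ∧ U ∈ D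

theorem RuleInstance.relabel {r : Rule} {k : ℕ} {S : Finset (Σ _ : ℕ, ℕ)} {n n' : ℕ} {T U : Tm}
    (h : RuleInstance r (bounded k S n) T U) {α : ℕ → ℕ} (hα : ∀ x ∈ T.varFinset ∪ U.varFinset, α x < n') :
    RuleInstance r (bounded k S n') (T.relabel α) (U.relabel α) := by
  obtain ⟨η, rfl, rfl, hT, hU⟩ := h
  exact ⟨fun x => (η x).relabel α, relabel_subst .., relabel_subst ..,
    relabel_mem_bounded hT fun x hx => hα x (Finset.mem_union_left _ hx),
    relabel_mem_bounded hU fun x hx => hα x (Finset.mem_union_right _ hx)⟩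

/-- The variables of the head of a rule occur in its body, so the at most `K` variables of `U`
account for both sides. The component `v 0` plays no role here and is taken to be `0`. -/
theorem RuleInstance.exists_template {P : Set ℕ} {h : ℕ} {r : Rule} (hr : r.Good P h) {k K n : ℕ}
    {S : Finset (Σ _ : ℕ, ℕ)}
    (hK : ∀ t : Tm, height t ≤ k → symbols t ⊆ S → t.varFinset.card ≤ K) {T U : Tm}
    (hTU : RuleInstance r (bounded k S (n + 1)) T U) :
    ∃ v ∈ Printer.tuples n (K + 1) fun _ => 0, ∃ T' U', RuleInstance r (bounded k S (K + 2)) T' U' ∧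
      T'.relabel (withSucc K n v) = T ∧ U'.relabel (withSucc K n v) = U := by
  have hsub : T.varFinset ⊆ U.varFinset := by
    obtain ⟨η, rfl, rfl, -, -⟩ := hTU
    rw [varFinset_subst, varFinset_subst]
    exact Finset.biUnion_subset_biUnion_of_subset_left _ hr.vars
  obtain ⟨-, -, -, -, hU⟩ := id hTU
  obtain ⟨v, hv, -, e, he⟩ := exists_tuple (Nat.zero_le n) hU.2.2 (hK U hU.1 hU.2.1)
  refine ⟨v, hv, T.relabel e, U.relabel e, hTU.relabel fun x hx => ?_,
    relabel_relabel_eq fun x hx => (he x (hsub hx)).2, relabel_relabel_eq fun x hx => (he x hx).2⟩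
  rw [Finset.union_eq_right.2 hsub] at hx
  exact (he x hx).1.trans (Nat.lt_succ_self _)

/-! ### Templates of moves -/

theorem relabel_slotTerm (m : ℕ) (η : ℕ → Tm) (q : Tm) (α : ℕ → ℕ) :
    (slotTerm m η q).relabel α = slotTerm m (fun x => (η x).relabel α) (q.relabel α) := by
  rw [slotTerm, slotTerm, relabel_subst]
  refine congrArg _ (funext fun x => ?_)
  rcases eq_or_ne x 0 with rfl | hx
  · simp
  · simp [hx]

theorem slotTerm_congr {m : ℕ} {η η' : ℕ → Tm} (q : Tm)
    (h : ∀ x ∈ (slotPattern m).varFinset, x ≠ 0 → η x = η' x) : slotTerm m η q = slotTerm m η' q := by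
  refine subst_congr fun x hx => ?_
  rcases eq_or_ne x 0 with rfl | hx0
  · simp
  · simp [hx0, h x hx hx0]

theorem mem_vars_slotTerm {m : ℕ} {η : ℕ → Tm} {q : Tm} {x y : ℕ} (hx : x ∈ (slotPattern m).varFinset)
    (hx0 : x ≠ 0) (hy : y ∈ (η x).varFinset) : y ∈ (slotTerm m η q).varFinset := by
  rw [slotTerm, varFinset_subst, Finset.mem_biUnion]
  exact ⟨x, hx, by simpa [hx0] using hy⟩

theorem vars_slotTerm_subset {m : ℕ} {η : ℕ → Tm} {q : Tm} {V : Finset ℕ} (hq : q.varFinset ⊆ V)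
    (h : ∀ x ∈ (slotPattern m).varFinset, x ≠ 0 → (η x).varFinset ⊆ V) :
    (slotTerm m η q).varFinset ⊆ V := by
  rw [slotTerm, varFinset_subst]
  refine Finset.biUnion_subset.2 fun x hx => ?_
  rcases eq_or_ne x 0 with rfl | hx0
  · simpa using hq
  · simpa [hx0] using h x hx hx0

/-- `T` and `U` are the last components of the nodes of a move from the position `i` to the
position `j`, both represented by variables. -/
def MoveInstance (m : ℕ) (D : Set Tm) (i j : ℕ) (T U : Tm) : Prop :=
  ∃ η : ℕ → Tm, T = slotTerm m η (tvar i) ∧ U = slotTerm m η (tvar j) ∧ T ∈ D ∧ U ∈ D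

theorem MoveInstance.relabel {m i j : ℕ} {k : ℕ} {S : Finset (Σ _ : ℕ, ℕ)} {n n' : ℕ} {T U : Tm}
    (h : MoveInstance m (bounded k S n) i j T U) {α : ℕ → ℕ} (hα : ∀ x, α x < n') :
    MoveInstance m (bounded k S n') (α i) (α j) (T.relabel α) (U.relabel α) := by
  obtain ⟨η, rfl, rfl, hT, hU⟩ := h
  exact ⟨fun x => (η x).relabel α, relabel_slotTerm .., relabel_slotTerm ..,
    relabel_mem_bounded hT fun x _ => hα x, relabel_mem_bounded hU fun x _ => hα x⟩

/-- Only the contents of the slots are renamed by `e`; the position and its successor become the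
variables `0` and `K + 1`. Renaming the whole terms would not do, since `i` may also occur in a
slot, and coincides with its successor when `n = 0`. -/
theorem MoveInstance.exists_template {m k K n i : ℕ} (hi : i ≤ n) {S : Finset (Σ _ : ℕ, ℕ)}
    (hK : ∀ t : Tm, height t ≤ k → symbols t ⊆ S → t.varFinset.card ≤ K) {T U : Tm}
    (hTU : MoveInstance m (bounded k S (n + 1)) i ((i + 1) % (n + 1)) T U) :
    ∃ v ∈ Printer.tuples n (K + 1) fun _ => 0, v 0 = i ∧
      ∃ T' U', MoveInstance m (bounded k S (K + 2)) 0 (K + 1) T' U' ∧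
        T'.relabel (withSucc K n v) = T ∧ U'.relabel (withSucc K n v) = U := by
  obtain ⟨η, rfl, rfl, hT, hU⟩ := hTU
  obtain ⟨v, hv, h0, e, he⟩ := exists_tuple hi hT.2.2 (hK _ hT.1 hT.2.1)
  have hback : ∀ q α, α = withSucc K n v → (slotTerm m (fun x => (η x).relabel e) q).relabel α =
      slotTerm m η (q.relabel α) := by
    rintro q _ rfl
    rw [relabel_slotTerm]
    exact slotTerm_congr _ fun x hx hx0 =>
      relabel_relabel_eq fun y hy => (he y (mem_vars_slotTerm hx hx0 hy)).2
  have e1 : (slotTerm m (fun x => (η x).relabel e) (tvar 0)).relabel (withSucc K n v) =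
      slotTerm m η (tvar i) := by
    rw [hback _ _ rfl]
    congr 1
    simp [tvar, withSucc, h0]
  have e2 : (slotTerm m (fun x => (η x).relabel e) (tvar (K + 1))).relabel (withSucc K n v) =
      slotTerm m η (tvar ((i + 1) % (n + 1))) := by
    rw [hback _ _ rfl]
    congr 1
    simp [tvar, withSucc, h0]
  have hvars : ∀ j, j < K + 2 →
      (slotTerm m (fun x => (η x).relabel e) (tvar j)).varFinset ⊆ Finset.range (K + 2) := by
    intro j hj
    refine vars_slotTerm_subset (by simpa [tvar] using hj) fun x hx hx0 y hy => ?_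
    rw [varFinset_relabel, Finset.mem_image] at hy
    obtain ⟨z, hz, rfl⟩ := hy
    exact Finset.mem_range.2 ((he z (mem_vars_slotTerm hx hx0 hz)).1.trans (Nat.lt_succ_self _))
  refine ⟨v, hv, h0, _, _, ⟨fun x => (η x).relabel e, rfl, rfl, ⟨?_, ?_, hvars 0 (by omega)⟩,
    ⟨?_, ?_, hvars _ (by omega)⟩⟩, e1, e2⟩
  -- Height and symbols are unchanged by renaming, so they can be read off the original terms.
  · rw [← height_relabel (withSucc K n v), e1]; exact hT.1
  · rw [← symbols_relabel _ (withSucc K n v), e1]; exact hT.2.1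
  · rw [← height_relabel (withSucc K n v), e2]; exact hU.1
  · rw [← symbols_relabel _ (withSucc K n v), e2]; exact hU.2.1

/-! ### The reduction -/

/-- The constant symbol of a letter; the marker of the ends of a word is `⋆`. -/
def letterConst {Sig : Finset ℕ} : Option Sig → ℕ
  | none => star
  | some a => a

theorem letterConst_before {Sig : Finset ℕ} (W : List Sig) (i : Fin (W.length + 1)) :
    letterConst (W.take i).getLast? = letter W i := by
  induction i using Fin.cases with
  | zero => simp [letterConst, letter]
  | succ j =>
    rw [Fin.val_succ, List.take_add_one, List.getElem?_eq_getElem j.2, Option.toList_some,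
      List.getLast?_concat]
    simp [letter, letterConst]

theorem letterConst_after {Sig : Finset ℕ} (W : List Sig) (i : Fin (W.length + 1)) :
    letterConst W[(i : ℕ)]? = letter W (i + 1) := by
  induction i using Fin.lastCases with
  | last => simp [letterConst, letter]
  | cast j => simp [letter, letterConst]

/-- The templates for the transitions `R` and, at a position, for the moves between a letter `a` and
a letter `b`. -/
inductive IsTemplate (R : List Rule) (m : ℕ) (D : Set Tm) (K a b : ℕ) : Template → Prop
  | rule (r : Rule) (hr : r ∈ R) (T U : Tm) (h : RuleInstance r D T U) :
      IsTemplate R m D K a b ⟨false, r.c, r.d, r.τ, T, r.c', r.d', r.σ, U⟩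
  | forward (T U : Tm) (h : MoveInstance m D 0 (K + 1) T U) :
      IsTemplate R m D K a b ⟨true, a, rgt, [], T, b, lft, [], U⟩
  | backward (T U : Tm) (h : MoveInstance m D 0 (K + 1) T U) :
      IsTemplate R m D K a b ⟨true, b, lft, [], U, a, rgt, [], T⟩

theorem finite_isTemplate (R : List Rule) (m : ℕ) {D : Set Tm} (hD : D.Finite) (K a b : ℕ) :
    {r | IsTemplate R m D K a b r}.Finite := by
  have h1 := ((List.finite_toSet R).prod (hD.prod hD)).image fun x : Rule × Tm × Tm =>
    (⟨false, x.1.c, x.1.d, x.1.τ, x.2.1, x.1.c', x.1.d', x.1.σ, x.2.2⟩ : Template)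
  have h2 := (hD.prod hD).image fun x : Tm × Tm => (⟨true, a, rgt, [], x.1, b, lft, [], x.2⟩ : Template)
  have h3 := (hD.prod hD).image fun x : Tm × Tm => (⟨true, b, lft, [], x.2, a, rgt, [], x.1⟩ : Template)
  refine ((h1.union h2).union h3).subset ?_
  rintro _ (⟨r, hr, T, U, h⟩ | ⟨T, U, h⟩ | ⟨T, U, h⟩) <;> obtain ⟨-, -, -, hT, hU⟩ := id h
  · exact Or.inl (Or.inl ⟨(r, T, U), ⟨hr, hT, hU⟩, rfl⟩)
  · exact Or.inl (Or.inr ⟨(T, U), ⟨hT, hU⟩, rfl⟩)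
  · exact Or.inr ⟨(T, U), ⟨hT, hU⟩, rfl⟩

theorem mem_reduction {A : Type} {K : ℕ} {tpl : Option A → Option A → List Template} {W : List A}
    {a : RawFlow} : a ∈ reduction K tpl W ↔ ∃ v ∈ Printer.tuples W.length (K + 1) fun _ => 0,
      ∃ r ∈ tpl (W.take (v 0)).getLast? W[v 0]?, r.flow (withSucc K W.length v) = a := by
  simp [reduction]

theorem wiringRel_wiringOf {L : List RawFlow} {X Y : Tm} :
    wiringRel (wiringOf L) X Y ↔ ∃ a ∈ L, ∃ η : ℕ → Tm, X = a.head.subst η ∧ Y = a.body.subst η := by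
  constructor
  · rintro ⟨f, ⟨a, ha, rfl⟩, h⟩
    exact ⟨a, ha, flowRel_toFlow.1 h⟩
  · rintro ⟨a, ha, h⟩
    exact ⟨_, ⟨a, ha, rfl⟩, flowRel_toFlow.2 h⟩

theorem flow_mem_stack {A : Type} (K : ℕ) (tpl : Option A → Option A → List Template) (W : List A) :
    wiringOf (reduction K tpl W) ∈ stack := by
  constructor
  · exact ((List.finite_toSet (reduction K tpl W)).image RawFlow.toFlow).subset fun f ⟨a, ha, h⟩ =>
      ⟨a, ha, h⟩
  · rintro f ⟨a, ha, rfl⟩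
    obtain ⟨v, -, r, -, rfl⟩ := mem_reduction.1 ha
    exact ⟨_, _, _, 0, rfl, rfl, rfl⟩

theorem height_flow (r : Template) (v : ℕ → ℕ) :
    (r.flow v).toFlow.height = max (r.τ.length + 1) (r.σ.length + 1) := by
  change max (height (seqApp _ _)) (height (seqApp _ _)) = _
  simp [height_seqApp, tvar, height]

theorem wheight_reduction_le {A : Type} {K : ℕ} {tpl : Option A → Option A → List Template} {h : ℕ}
    (htpl : ∀ a b, ∀ r ∈ tpl a b, r.τ.length + 1 ≤ h ∧ r.σ.length + 1 ≤ h) (W : List A) :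
    wheight (wiringOf (reduction K tpl W)) ≤ h := by
  refine csSup_le' ?_
  rintro _ ⟨f, ⟨a, ha, rfl⟩, rfl⟩
  obtain ⟨v, -, r, hr, rfl⟩ := mem_reduction.1 ha
  rw [height_flow]
  exact max_le (htpl _ _ r hr).1 (htpl _ _ r hr).2

/-- The injective coding of phase, letter, direction and term by a unary symbol identifies instances
of the printed flows with alternating steps. Every renamed template is a step, and by the two
`exists_template` lemmas every step arises in this way. -/
theorem longPaths_reduction {P : Set ℕ} {h : ℕ} {R : List Rule} (hR : ∀ r ∈ R, r.Good P h) {m k K : ℕ}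
    {S : Finset (Σ _ : ℕ, ℕ)}
    (hK : ∀ t : Tm, height t ≤ k → symbols t ⊆ S → t.varFinset.card ≤ K) {Sig : Finset ℕ}
    {tpl : Option Sig → Option Sig → List Template}
    (htpl : ∀ a b r, r ∈ tpl a b ↔
      IsTemplate R m (bounded k S (K + 2)) K (letterConst a) (letterConst b) r) (W : List Sig) :
    LongPaths (wiringRel (wiringOf (reduction K tpl W))) ↔
      LongPaths (alternate (ruleStep R (bounded k S (W.length + 1)))
        (moveSteps (letter W) (fun i => tvar i) m (bounded k S (W.length + 1)))) := by
  -- The stack remains as the argument of the state symbol.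
  have hφ : Function.Injective fun x : Bool × Node => app (code x.1 x.2.2.1 x.2.2.2.1 x.2.2.2.2) x.2.1 := by
    rintro ⟨b, s, c, d, y⟩ ⟨b', s', c', d', y'⟩ h
    obtain ⟨h1, rfl⟩ := app_inj.1 h
    obtain ⟨rfl, rfl, rfl, rfl⟩ := code_inj h1
    rfl
  have : Nonempty (Bool × Node) := ⟨(true, tvar 0, 0, 0, tvar 0)⟩
  refine longPaths_congr hφ fun X Y => ?_
  rw [wiringRel_wiringOf]
  have hflow : ∀ (r : Template) (v : ℕ → ℕ) (s : Tm),
      ((r.flow v).head.subst fun _ => s) = app (code r.phase r.c r.d (r.T.relabel v)) (seqApp r.τ s) ∧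
      ((r.flow v).body.subst fun _ => s) = app (code (!r.phase) r.c' r.d' (r.U.relabel v)) (seqApp r.σ s) :=
    fun r v s => ⟨subst_seqApp .., subst_seqApp ..⟩
  have hsucc : ∀ i : Fin (W.length + 1), ((i + 1 : Fin (W.length + 1)) : ℕ) = (i + 1) % (W.length + 1) :=
    fun i => by simp [Fin.val_add]
  constructor
  · rintro ⟨a, ha, η, rfl, rfl⟩
    obtain ⟨v, hv, r, hr, rfl⟩ := mem_reduction.1 ha
    have hv' := withSucc_lt (K := K) (le_of_mem_tuples hv)
    rw [htpl] at hr
    have hη : ∀ (r : Template) (v : ℕ → ℕ),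
        ((r.flow v).head.subst η) = app (code r.phase r.c r.d (r.T.relabel v)) (seqApp r.τ (η 0)) ∧
        ((r.flow v).body.subst η) = app (code (!r.phase) r.c' r.d' (r.U.relabel v)) (seqApp r.σ (η 0)) :=
      fun r v => ⟨subst_seqApp .., subst_seqApp ..⟩
    rw [(hη _ _).1, (hη _ _).2]
    -- The letters that selected the template are those on either side of the position `v 0`.
    let i : Fin (W.length + 1) := ⟨v 0, Nat.lt_succ_of_le (le_of_mem_tuples hv 0)⟩
    have hi : letterConst (W.take (v 0)).getLast? = letter W i := letterConst_before W i
    have hi' : letterConst W[v 0]? = letter W (i + 1) := letterConst_after W i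
    rw [hi, hi'] at hr
    have hw0 : withSucc K W.length v 0 = i := withSucc_of_ne (by omega)
    have hw1 : withSucc K W.length v (K + 1) = ((i + 1 : Fin (W.length + 1)) : ℕ) := by
      rw [hsucc]; exact if_pos rfl
    rcases hr with ⟨r, hr, T, U, h⟩ | ⟨T, U, h⟩ | ⟨T, U, h⟩
    · obtain ⟨θ, h1, h2, h3, h4⟩ := h.relabel fun x _ => hv' x
      refine ⟨(false, _, _, _, _), (true, _, _, _, _), rfl, rfl, rfl, r, hr, η 0, θ, ?_, ?_, h1 ▸ h3, h2 ▸ h4⟩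
      · exact congrArg (fun t => (seqApp r.τ (η 0), r.c, r.d, t)) h1
      · exact congrArg (fun t => (seqApp r.σ (η 0), r.c', r.d', t)) h2
    · obtain ⟨θ, h1, h2, h3, h4⟩ := h.relabel hv'
      rw [hw0] at h1
      rw [hw1] at h2
      refine ⟨(true, _, _, _, _), (false, _, _, _, _), rfl, rfl, rfl, Or.inl ⟨i, η 0, θ, ?_, ?_, h1 ▸ h3, h2 ▸ h4⟩⟩
      · simp only [h1]
      · simp only [h2]
    · obtain ⟨θ, h1, h2, h3, h4⟩ := h.relabel hv'
      rw [hw0] at h1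
      rw [hw1] at h2
      refine ⟨(true, _, _, _, _), (false, _, _, _, _), rfl, rfl, rfl, Or.inr ⟨i, η 0, θ, ?_, ?_, h1 ▸ h3, h2 ▸ h4⟩⟩
      · simp only [h1]
      · simp only [h2]
  · have hmove : ∀ x y : Node, moveStep (letter W) (fun i => tvar i) m (bounded k S (W.length + 1)) x y →
        ∃ v ∈ Printer.tuples W.length (K + 1) fun _ => 0, ∃ (s : Tm) (T U : Tm),
          MoveInstance m (bounded k S (K + 2)) 0 (K + 1) T U ∧
          x = (s, letterConst (W.take (v 0)).getLast?, rgt, T.relabel (withSucc K W.length v)) ∧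
          y = (s, letterConst W[v 0]?, lft, U.relabel (withSucc K W.length v)) := by
      rintro _ _ ⟨i, s, η, rfl, rfl, h1, h2⟩
      change slotTerm m η (tvar ((i + 1 : Fin (W.length + 1)) : ℕ)) ∈ _ at h2
      rw [hsucc] at h2
      obtain ⟨v, hv, h0, T, U, hTU, e1, e2⟩ := MoveInstance.exists_template (Nat.lt_succ_iff.1 i.2) hK
        ⟨η, rfl, rfl, h1, h2⟩
      refine ⟨v, hv, s, T, U, hTU, ?_, ?_⟩
      · rw [h0, letterConst_before, e1]
      · rw [h0, letterConst_after, e2, ← hsucc]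
    rintro ⟨⟨b, x⟩, ⟨b', y⟩, rfl, rfl, hb, hxy⟩
    obtain rfl : b' = !b := hb
    cases b
    · obtain ⟨r, hr, s, η, rfl, rfl, h1, h2⟩ := hxy
      obtain ⟨v, hv, T, U, hTU, e1, e2⟩ := RuleInstance.exists_template (hR r hr) hK ⟨η, rfl, rfl, h1, h2⟩
      refine ⟨_, mem_reduction.2 ⟨v, hv, _, (htpl _ _ _).2 (.rule r hr T U hTU), rfl⟩, fun _ => s, ?_, ?_⟩
      · rw [(hflow _ _ _).1, e1]
      · rw [(hflow _ _ _).2, e2]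
    · rcases hxy with hxy | hxy
      · obtain ⟨v, hv, s, T, U, hTU, rfl, rfl⟩ := hmove _ _ hxy
        refine ⟨_, mem_reduction.2 ⟨v, hv, _, (htpl _ _ _).2 (.forward T U hTU), rfl⟩, fun _ => s, ?_, ?_⟩
        · rw [(hflow _ _ _).1]; rfl
        · rw [(hflow _ _ _).2]; rfl
      · obtain ⟨v, hv, s, T, U, hTU, rfl, rfl⟩ := hmove _ _ hxy
        refine ⟨_, mem_reduction.2 ⟨v, hv, _, (htpl _ _ _).2 (.backward T U hTU), rfl⟩, fun _ => s, ?_, ?_⟩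
        · rw [(hflow _ _ _).1]; rfl
        · rw [(hflow _ _ _).2]; rfl

end UnaryResolution

open UnaryResolution
theorem mainTheorem9 (Sig : Finset ℕ) (P : Set ℕ) (hP : P.Infinite)
    (hSigP : Disjoint (Sig : Set ℕ) P) (hstar : UnaryResolution.star ∉ Sig)
    (hstarP : UnaryResolution.star ∉ P) (hlftP : lft ∉ P) (hrgtP : rgt ∉ P)
    (m : ℕ) (O : Set UnaryResolution.Flow) (hO : O ∈ stackObservations Sig P) :
    ∃ Red : List Sig → List RawFlow, FPtime Red ∧
      ∀ W : List Sig,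
        wiringOf (Red W) ∈ stack ∧
        wheight (wiringOf (Red W)) ≤ wheight O ∧
        ∀ p : Fin (W.length + 1) → ℕ, Function.Injective p → (∀ i, p i ∈ P) →
          (Nilpotent (wiringOf (Red W)) ↔ Nilpotent (wmul O (wordRep m W p))) := by
  obtain ⟨R, hgood, hR⟩ := exists_rules hO
  -- In both cases the product is empty and the empty wiring is printed. When there is no rule this
  -- is forced by the height: the flows for moves have height `1`, while the bound is `0`.
  by_cases h0 : m = 0 ∨ R = []
  · refine ⟨_, fptime_reduction 0 fun _ _ => [], fun W => ⟨flow_mem_stack .., ?_, fun p _ _ => ?_⟩⟩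
    · exact wheight_reduction_le (by simp) W
    · have h1 : wiringOf (reduction 0 (fun _ _ => []) W) = ∅ := by simp [wiringOf, reduction]
      have h2 : wmul O (wordRep m W p) = ∅ := by
        rcases h0 with rfl | rfl
        · exact wmul_wordRep_zero hR W p
        · rw [eq_empty_iff_wiringRel]
          intro X Z h
          obtain ⟨Y, h, -⟩ := (wiringRel_wmul ..).1 h
          obtain ⟨r, hr, -⟩ := (hR ..).1 h
          simp at hr
      rw [h1, h2]
  · push Not at h0
    obtain ⟨m, rfl⟩ := Nat.exists_eq_succ_of_ne_zero h0.1
    obtain ⟨k, S, hB⟩ := exists_truncBounds R m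
    obtain ⟨K, hK⟩ := exists_card_vars_le k S
    let tpl : Option Sig → Option Sig → List Template := fun a b =>
      (finite_isTemplate R m (finite_bounded k S (K + 2)) K (letterConst a)
        (letterConst b)).toFinset.toList
    have htpl : ∀ a b r, r ∈ tpl a b ↔
        IsTemplate R m (bounded k S (K + 2)) K (letterConst a) (letterConst b) r := by
      intro a b r
      simp [tpl]
    refine ⟨_, fptime_reduction K tpl, fun W => ⟨flow_mem_stack .., ?_, fun p hp hpP => ?_⟩⟩
    · refine wheight_reduction_le (fun a b r hr => ?_) W
      obtain ⟨r₀, hr₀⟩ := List.exists_mem_of_ne_nil R h0.2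
      -- A rule exists, so the height of the observation leaves room for the moves, whose sides
      -- consist of a single state symbol.
      have h1 : 1 ≤ wheight O := (Nat.le_add_left _ _).trans (hgood r₀ hr₀).length_τ
      rcases (htpl a b r).1 hr with ⟨r, hr', T, U, h⟩ | ⟨T, U, h⟩ | ⟨T, U, h⟩
      · exact ⟨(hgood r hr').length_τ, (hgood r hr').length_σ⟩
      · exact ⟨h1, h1⟩
      · exact ⟨h1, h1⟩
    · rw [nilpotent_iff, nilpotent_iff, longPaths_reduction hgood hK htpl W, longPaths_wmul hR,
        longPaths_truncate hgood hB (letter W) hp hpP]
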